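/- For every large $n$ let $X_1,\dots,X_n$ (possibly depending on $n$; all samples are defined on one probability space) be independent real random variables following a multiple change-point model: there are $K_n\ge 1$ change-points $1=\tau_0<\tau_1<\cdots<\tau_{K_n}<\tau_{K_n+1}=n+1$ such that $X_i$ has C.D.F. $F_k$ whenever $\tau_{k-1}\le i\le\tau_k-1$, $1\le k\le K_n+1$ (the $\tau_k$ and $F_k$ may depend on $n$). Let $\overline K_n\ge K_n$ be a known upper bound on the number of change-points, let $\lambda_n=\min_{1\le k\le K_n+1}(\tau_k-\tau_{k-1})$, let $\widehat F_n$ be the empirical C.D.F. of $X_1,\dots,X_n$, and let $$F(u)=\sum_{k=1}^{K_n+1}\frac{\tau_k-\tau_{k-1}}{n}F_k(u)$$ be the C.D.F. of the pooled sample (it may depend on $n$). With $\mathrm{kl}(p,q)=p\log\frac pq+(1-p)\log\frac{1-p}{1-q}$ put $$\eta_r(u)=\mathrm{kl}\Bigl(F_r(u),\tfrac{F_r(u)+F_{r+1}(u)}2\Bigr)+\mathrm{kl}\Bigl(F_{r+1}(u),\tfrac{F_r(u)+F_{r+1}(u)}2\Bigr),\qquad 1\le r\le K_n .$$ Assume: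 (A1) for all large $n$, $F_1,\dots,F_{K_n+1}$ are continuous and $F_k\ne F_{k+1}$ for $1\le k\le K_n$; (A2) $\lambda_n\to\infty$; (A3) $\sup_u|\widehat F_n(u)-F(u)|\to0$ almost surely; (A4) $\min_{1\le r\le K_n}\int_{-\infty}^{\infty}\frac{\eta_r(u)}{F(u)(1-F(u))}\,dF(u)$ is bounded below, for all large $n$, by a positive constant independent of $n$. For $L\ge1$ and $1=\tau_0'<\tau_1'<\cdots<\tau_L'<\tau_{L+1}'=n+1$ let $$R_n(\tau_1',\dots,\tau_L')=n\sum_{k=0}^{L}\sum_{l=2}^{n-1}(\tau_{k+1}'-\tau_k')\,\frac{\widehat F_{kl}\log\widehat F_{kl}+(1-\widehat F_{kl})\log(1-\widehat F_{kl})}{l(n-l)},$$ where $0\log0=0$ and $\widehat F_{kl}$ is the value at the $l$-th order statistic $X_{(l)}$ of the whole sample of the empirical C.D.F. of $X_{\tau_k'},\dots,X_{\tau_{k+1}'-1}$. Let $$\mathrm{BIC}_L=-\max_{\tau_1'<\cdots<\tau_L'}R_n(\tau_1',\dots,\tau_L')+L\zeta_n,\qquad \zeta_n=\overline K_n^{3}(\log\overline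 K_n)^2(\log n)^{2+c},$$ where $c>0$ is any constant, and let $\widehat K_n$ be any minimiser of $\mathrm{BIC}_L$ over $1\le L\le\overline K_n$. If $\lambda_n/(\overline K_n\zeta_n)\to\infty$ (read as satisfied when $\overline K_n=1$, where $\zeta_n=0$), then $$\Pr(\widehat K_n=K_n)\to1\qquad\text{as }n\to\infty .$$ -/

import Mathlib

open MeasureTheory ProbabilityTheory Filter Topology

namespace NMCD

noncomputable section

/-! ### Segmentations of a sample of size `n`

The observations are `x 1, …, x n`. -/

/-- `t` encodes the change-points `1 < t 1 < ⋯ < t L ≤ n`, completed by the conventions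
`t 0 = 1` and `t (L + 1) = n + 1`; the `k`-th segment is `{t k, …, t (k + 1) - 1}`. -/
def IsSegmentation (n L : ℕ) (t : Fin (L + 2) → ℕ) : Prop :=
  StrictMono t ∧ t 0 = 1 ∧ t (Fin.last (L + 1)) = n + 1

/-- The minimal length of a segment. -/
def minSpacing {K : ℕ} (t : Fin (K + 2) → ℕ) : ℕ :=
  Finset.univ.inf' Finset.univ_nonempty fun k : Fin (K + 1) => t k.succ - t k.castSucc

/-! ### The objective function and the BIC criterion (deterministic functions of the data) -/

/-- Empirical C.D.F. at `u` of the subsample `x a, …, x (b - 1)`. -/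
def empCDF (x : ℕ → ℝ) (a b : ℕ) (u : ℝ) : ℝ :=
  (((Finset.Ico a b).filter fun i => x i ≤ u).card : ℝ) / ((b : ℝ) - (a : ℝ))

/-- The `l`-th order statistic (`1 ≤ l ≤ n`) of `x 1, …, x n`. -/
def orderStat (n : ℕ) (x : ℕ → ℝ) (l : ℕ) : ℝ :=
  if h : 1 ≤ l ∧ l ≤ n then
    x ((Tuple.sort (fun i : Fin n => x ((i : ℕ) + 1)) ⟨l - 1, by omega⟩ : ℕ) + 1)
  else 0

/-- `p log p + (1 - p) log (1 - p)`, with `0 log 0 = 0`. -/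
def bernoulliLogLik (p : ℝ) : ℝ :=
  p * Real.log p + (1 - p) * Real.log (1 - p)

/-- The integrated nonparametric log-likelihood
`R_n = n ∑_{k=0}^{L} ∑_{l=2}^{n-1} (t_{k+1} - t_k)
  {F̂_{kl} log F̂_{kl} + (1 - F̂_{kl}) log (1 - F̂_{kl})} / (l (n - l))`,
where `F̂_{kl}` is the empirical C.D.F. of the `k`-th segment at the `l`-th order statistic of
the whole sample. -/
def Rn (n : ℕ) (x : ℕ → ℝ) {L : ℕ} (t : Fin (L + 2) → ℕ) : ℝ :=
  (n : ℝ) * ∑ k : Fin (L + 1), ∑ l ∈ Finset.Icc 2 (n - 1),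
    ((t k.succ : ℝ) - (t k.castSucc : ℝ)) *
      bernoulliLogLik (empCDF x (t k.castSucc) (t k.succ) (orderStat n x l)) /
        ((l : ℝ) * ((n : ℝ) - (l : ℝ)))

/-- The maximum of `R_n` over all choices of `L` change-points.  The set of choices is finite, and
it is nonempty as soon as `L < n`, so that the supremum is then a maximum. -/
def maxRn (n : ℕ) (x : ℕ → ℝ) (L : ℕ) : ℝ :=
  sSup {y : ℝ | ∃ t : Fin (L + 2) → ℕ, IsSegmentation n L t ∧ y = Rn n x t}

/-- The criterion `BIC_L` with penalty `ζ` per change-point. -/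
def BIC (n : ℕ) (x : ℕ → ℝ) (ζ : ℝ) (L : ℕ) : ℝ :=
  -maxRn n x L + (L : ℝ) * ζ

/-- `k` is a minimiser of `L ↦ BIC_L` over `1 ≤ L ≤ Kbar`. -/
def IsBICMinimizer (n : ℕ) (x : ℕ → ℝ) (ζ : ℝ) (Kbar k : ℕ) : Prop :=
  k ∈ Finset.Icc 1 Kbar ∧ ∀ L ∈ Finset.Icc 1 Kbar, BIC n x ζ k ≤ BIC n x ζ L

/-- The penalty `ζ_n = K̄³ (log K̄)² (log n)^{2+c}`. -/
def zeta (c : ℝ) (n Kbar : ℕ) : ℝ :=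
  (Kbar : ℝ) ^ 3 * Real.log (Kbar : ℝ) ^ 2 * Real.log (n : ℝ) ^ (2 + c)

/-! ### The multiple change-point model -/

/-- The multiple change-point model for a sample `X 1, …, X n`: the observations are independent,
the change-points are `τ 1 < ⋯ < τ K`, and all observations of the `k`-th segment have the
law `ν k`. -/
structure IsModel {Ω : Type*} [MeasurableSpace Ω] (P : Measure Ω) (n K : ℕ)
    (τ : Fin (K + 2) → ℕ) (ν : Fin (K + 1) → Measure ℝ) (X : ℕ → Ω → ℝ) : Prop where
  segmentation : IsSegmentation n K τ
  indep : iIndepFun (fun i : Finset.Icc 1 n => X i) P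
  law : ∀ (k : Fin (K + 1)) (i : ℕ), τ k.castSucc ≤ i → i < τ k.succ → HasLaw (X i) (ν k) P

/-- The distribution of the pooled sample: the mixture of the segment laws, weighted by the
proportions of the segments. -/
def pooledLaw (n : ℕ) {K : ℕ} (τ : Fin (K + 2) → ℕ) (ν : Fin (K + 1) → Measure ℝ) : Measure ℝ :=
  ∑ k : Fin (K + 1), ENNReal.ofReal (((τ k.succ : ℝ) - (τ k.castSucc : ℝ)) / (n : ℝ)) • ν k

/-- Kullback–Leibler distance between the Bernoulli distributions with success probabilities
`p` and `q`. -/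
def bernoulliKL (p q : ℝ) : ℝ :=
  p * Real.log (p / q) + (1 - p) * Real.log ((1 - p) / (1 - q))

/-- `η(u; F, (F + G)/2) + η(u; G, (F + G)/2)` for the C.D.F.s `F`, `G` of the laws `μ`, `ρ`. -/
def etaFun (μ ρ : Measure ℝ) (u : ℝ) : ℝ :=
  bernoulliKL (cdf μ u) ((cdf μ u + cdf ρ u) / 2) +
    bernoulliKL (cdf ρ u) ((cdf μ u + cdf ρ u) / 2)

/-- Signal strength `∫ η_r(u) / {F(u) (1 - F(u))} dF(u)` of the `r`-th change, where `F` is the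
C.D.F. of the pooled sample. -/
def signal (n : ℕ) {K : ℕ} (τ : Fin (K + 2) → ℕ) (ν : Fin (K + 1) → Measure ℝ) (r : Fin K) : ℝ :=
  ∫ u, etaFun (ν r.castSucc) (ν r.succ) u /
    (cdf (pooledLaw n τ ν) u * (1 - cdf (pooledLaw n τ ν) u)) ∂(pooledLaw n τ ν)

end

end NMCD

/-! For each level l, the inner sum of R_n is the maximal Bernoulli log-likelihood `segLL` of the
indicators 1{X_i ≤ X_(l)}, summed over the segments. The levels carry weights n/(l(n-l)) of total
mass at most 4 log n. The heart of the proof is a deterministic inequality on a good event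
(`Rn_le`): for every segmentation t with L change-points, R_n(t) ≤ R_n(τ) + C (log n)² (L+1) K - c
λ_n (K-L)₊. The middle term is at most ζ_n/2 and each missing change-point costs at least 2ζ_n, so a
minimiser of BIC can neither add nor omit a change-point (`eq_of_isBICMinimizer`).

At a fixed level the good event is `Fits`: on every interval inside a true segment the maximised
likelihood is at most exp D times the true one, with D = 10 log n. It is likely because an indicator
pattern violating this has probability at most exp(-D) times its maximised likelihood, and the
maximised likelihoods of all patterns of length m add up to at most m + 1
(`IsModel.measure_not_fit_le`). Cut t further at the midpoints of the inner true segments. The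
(L+1)K resulting bits contain at most one true change-point each and cost at most 3D each. At least
K-L of the pieces between midpoints are left whole by t, and there one frequency is fitted across a
true change: the Hellinger remainder in Gibbs' inequality makes this lose order λ_n
(`Fits.segLL_piece_le`).

The levels X_(l) are random. They are replaced by the ends of the cells of a grid of n⁵ quantiles of
F, which changes no indicator when no two observations share a cell (`orderStat_grid`,
`IsModel.measure_collision_le`). A union bound over fixed levels then suffices.

For the signal, the integral in (A4) is at most twice its Hellinger analogue, which may be truncated
to a central region δ < F ≤ 1-δ. Chebyshev's inequality passes to the average over the sample. On
the central region `Fits` also bounds the ranks l and n-l by 3nF and 3n(1-F), so the weights are at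
least 1/(9nF(1-F)), and the weighted Hellinger signal stays bounded below
(`IsModel.le_sum_weight_mul_hell`). -/

namespace NMCD

/-! ### Squared Hellinger distance between Bernoulli distributions -/

/-- Squared Hellinger distance (without the factor `1/2`) between the Bernoulli distributions with
success probabilities `p` and `q`. -/
noncomputable def hell (p q : ℝ) : ℝ :=
  (√p - √q) ^ 2 + (√(1 - p) - √(1 - q)) ^ 2

theorem hell_nonneg (p q : ℝ) : 0 ≤ hell p q := by unfold hell; positivity

theorem hell_comm (p q : ℝ) : hell p q = hell q p := by unfold hell; ring

theorem hell_le_two_mul (a b c : ℝ) : hell a c ≤ 2 * (hell a b + hell b c) := by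
  unfold hell
  nlinarith [sq_nonneg ((√a - √b) - (√b - √c)),
    sq_nonneg ((√(1 - a) - √(1 - b)) - (√(1 - b) - √(1 - c)))]

theorem hell_le_three_mul (a b c d : ℝ) :
    hell a d ≤ 3 * (hell a b + hell b c + hell c d) := by
  have key : ∀ x y z : ℝ, (x + y + z) ^ 2 ≤ 3 * (x ^ 2 + y ^ 2 + z ^ 2) := fun x y z => by
    nlinarith [sq_nonneg (x - y), sq_nonneg (y - z), sq_nonneg (x - z)]
  have h1 := key (√a - √b) (√b - √c) (√c - √d)
  have h2 := key (√(1 - a) - √(1 - b)) (√(1 - b) - √(1 - c)) (√(1 - c) - √(1 - d))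
  unfold hell
  have e1 : √a - √b + (√b - √c) + (√c - √d) = √a - √d := by ring
  have e2 : √(1 - a) - √(1 - b) + (√(1 - b) - √(1 - c)) + (√(1 - c) - √(1 - d))
    = √(1 - a) - √(1 - d) := by ring
  rw [e1] at h1
  rw [e2] at h2
  linarith

theorem sqrt_sub_sqrt_sq_le {p q : ℝ} (hp : 0 ≤ p) (hq : 0 ≤ q) : (√p - √q) ^ 2 ≤ |p - q| := by
  have h : p - q = (√p - √q) * (√p + √q) := by
    have := Real.sq_sqrt hp
    have := Real.sq_sqrt hq
    nlinarith
  rw [h, abs_mul, ← sq_abs, sq]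
  apply mul_le_mul_of_nonneg_left _ (abs_nonneg _)
  rw [abs_of_nonneg (by positivity : (0 : ℝ) ≤ √p + √q), abs_le]
  constructor <;> linarith [Real.sqrt_nonneg p, Real.sqrt_nonneg q]

theorem hell_le_abs {p q : ℝ} (hp : p ∈ Set.Icc (0 : ℝ) 1) (hq : q ∈ Set.Icc (0 : ℝ) 1) :
    hell p q ≤ 2 * |p - q| := by
  have h1 := sqrt_sub_sqrt_sq_le hp.1 hq.1
  have h2 := sqrt_sub_sqrt_sq_le (sub_nonneg.2 hp.2) (sub_nonneg.2 hq.2)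
  have e : |1 - p - (1 - q)| = |p - q| := by rw [abs_sub_comm p q]; congr 1; ring
  rw [e] at h2
  unfold hell
  linarith

/-- This is log y ≤ y - 1 at y = √q / √p, multiplied by 2p. The last hypothesis excludes q = 0 < p,
where `Real.log 0 = 0` can make the bound false. -/
theorem mul_log_le_sub_sqrt {p q : ℝ} (hp : 0 ≤ p) (hq : 0 ≤ q) (h : p ≠ 0 → q ≠ 0) :
    p * Real.log q + 2 * p - 2 * (√p * √q) ≤ p * Real.log p := by
  rcases hp.eq_or_lt with rfl | hp'
  · simp
  have hq' : 0 < q := lt_of_le_of_ne hq (h hp'.ne').symm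
  have h1 : Real.log (√q / √p) ≤ √q / √p - 1 :=
    Real.log_le_sub_one_of_pos (by positivity)
  rw [Real.log_div (by positivity) (by positivity), Real.log_sqrt hq, Real.log_sqrt hp] at h1
  have h2 : p * (√q / √p) = √p * √q := by
    have := Real.mul_self_sqrt hp
    have h3 : √p ≠ 0 := by positivity
    field_simp
    nlinarith
  nlinarith [mul_le_mul_of_nonneg_left h1 hp]

/-- The Gibbs inequality for Bernoulli distributions, with a Hellinger remainder. -/
theorem gibbs_hell {p q : ℝ} (hp : p ∈ Set.Icc (0 : ℝ) 1) (hq : q ∈ Set.Icc (0 : ℝ) 1)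
    (h0 : p ≠ 0 → q ≠ 0) (h1 : p ≠ 1 → q ≠ 1) :
    p * Real.log q + (1 - p) * Real.log (1 - q) + hell p q ≤ bernoulliLogLik p := by
  have a1 := mul_log_le_sub_sqrt hp.1 hq.1 h0
  have a2 := mul_log_le_sub_sqrt (sub_nonneg.2 hp.2) (sub_nonneg.2 hq.2)
    (fun h => by
      have := h1 (fun e => h (by rw [e]; ring))
      intro e; exact this (by linarith))
  unfold bernoulliLogLik hell
  have := Real.sq_sqrt hp.1
  have := Real.sq_sqrt hq.1
  have := Real.sq_sqrt (sub_nonneg.2 hp.2)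
  have := Real.sq_sqrt (sub_nonneg.2 hq.2)
  nlinarith

theorem mul_log_div_le {p m : ℝ} (hp : 0 ≤ p) (hm : 0 < m) :
    p * Real.log (p / m) ≤ p * (p / m - 1) := by
  rcases hp.eq_or_lt with rfl | hp'
  · simp
  exact mul_le_mul_of_nonneg_left (Real.log_le_sub_one_of_pos (by positivity)) hp

/-- The inequality log y ≤ y - 1 leaves (p - q)² / (p + q); factor p - q through square roots and
use (√p + √q)² ≤ 2(p + q). -/
theorem mul_log_div_mid_add_le {p q : ℝ} (hp : 0 ≤ p) (hq : 0 ≤ q) :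
    p * Real.log (p / ((p + q) / 2)) + q * Real.log (q / ((p + q) / 2)) ≤ 2 * (√p - √q) ^ 2 := by
  rcases (add_nonneg hp hq).eq_or_lt with h | h
  · have : p = 0 := by linarith
    have : q = 0 := by linarith
    subst p q
    simp
  have hm : 0 < (p + q) / 2 := by linarith
  have a1 := mul_log_div_le hp hm
  have a2 := mul_log_div_le hq hm
  have e : p * (p / ((p + q) / 2) - 1) + q * (q / ((p + q) / 2) - 1) = (p - q) ^ 2 / (p + q) := by
    field_simp
    ring
  have e2 : (p - q) ^ 2 / (p + q) ≤ 2 * (√p - √q) ^ 2 := by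
    rw [div_le_iff₀ h]
    have hh : p - q = (√p - √q) * (√p + √q) := by
      have := Real.sq_sqrt hp
      have := Real.sq_sqrt hq
      nlinarith
    have h3 : (√p + √q) ^ 2 ≤ 2 * (p + q) := by
      have := Real.sq_sqrt hp
      have := Real.sq_sqrt hq
      nlinarith [sq_nonneg (√p - √q)]
    rw [hh, mul_pow]
    nlinarith [mul_le_mul_of_nonneg_left h3 (sq_nonneg (√p - √q))]
  linarith

/-- Converts the divergence of (A4) into Hellinger distance, which obeys a triangle inequality up to
constants and is the remainder in Gibbs' inequality. -/
theorem bernoulliKL_mid_add_le {p q : ℝ} (hp : p ∈ Set.Icc (0 : ℝ) 1)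
    (hq : q ∈ Set.Icc (0 : ℝ) 1) :
    bernoulliKL p ((p + q) / 2) + bernoulliKL q ((p + q) / 2) ≤ 2 * hell p q := by
  have a1 := mul_log_div_mid_add_le hp.1 hq.1
  have a2 := mul_log_div_mid_add_le (sub_nonneg.2 hp.2) (sub_nonneg.2 hq.2)
  have e : (1 - p + (1 - q)) / 2 = 1 - (p + q) / 2 := by ring
  rw [e] at a2
  unfold bernoulliKL hell
  linarith

/-! ### The log-likelihood of a segment at a fixed level -/

/-- Maximal log-likelihood of the indicators `1{x i ≤ v}`, `a ≤ i < b`, in the Bernoulli model. -/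
noncomputable def segLL (x : ℕ → ℝ) (v : ℝ) (a b : ℕ) : ℝ :=
  ((b : ℝ) - (a : ℝ)) * bernoulliLogLik (empCDF x a b v)

/-- Likelihood of the indicator `1{x i ≤ v}` under the Bernoulli distribution with success
probability `q`. -/
noncomputable def lik (x : ℕ → ℝ) (v q : ℝ) (i : ℕ) : ℝ := if x i ≤ v then q else 1 - q

theorem lik_nonneg (x : ℕ → ℝ) (v : ℝ) {q : ℝ} (hq : q ∈ Set.Icc (0 : ℝ) 1) (i : ℕ) :
    0 ≤ lik x v q i := by
  unfold lik
  split_ifs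
  · exact hq.1
  · linarith [hq.2]

theorem segLL_self (x : ℕ → ℝ) (v : ℝ) (a : ℕ) : segLL x v a a = 0 := by simp [segLL]

theorem empCDF_mul_length (x : ℕ → ℝ) (v : ℝ) {a b : ℕ} (hab : a ≤ b) :
    ((b : ℝ) - a) * empCDF x a b v = (((Finset.Ico a b).filter fun i => x i ≤ v).card : ℝ) := by
  unfold empCDF
  rcases hab.eq_or_lt with rfl | h
  · simp
  · have : (0 : ℝ) < (b : ℝ) - a := by
      have : (a : ℝ) < b := by exact_mod_cast h
      linarith
    field_simp

theorem card_filter_not_le (x : ℕ → ℝ) (v : ℝ) {a b : ℕ} (hab : a ≤ b) :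
    (((Finset.Ico a b).filter fun i => ¬ x i ≤ v).card : ℝ)
      = ((b : ℝ) - a) * (1 - empCDF x a b v) := by
  have h := Finset.card_filter_add_card_filter_not (s := Finset.Ico a b) (fun i => x i ≤ v)
  have h' : (((Finset.Ico a b).filter fun i => x i ≤ v).card : ℝ) +
      (((Finset.Ico a b).filter fun i => ¬ x i ≤ v).card : ℝ) = (b : ℝ) - a := by
    rw [← Nat.cast_sub hab, ← Nat.card_Ico]
    exact_mod_cast h
  rw [mul_sub, empCDF_mul_length x v hab]
  linarith

theorem empCDF_mem_Icc (x : ℕ → ℝ) (v : ℝ) {a b : ℕ} (hab : a ≤ b) :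
    empCDF x a b v ∈ Set.Icc (0 : ℝ) 1 := by
  have hab' : (0 : ℝ) ≤ (b : ℝ) - a := sub_nonneg.2 (by exact_mod_cast hab)
  refine ⟨div_nonneg (Nat.cast_nonneg _) hab', div_le_one_of_le₀ ?_ hab'⟩
  have h1 := Finset.card_filter_le (Finset.Ico a b) (fun i => x i ≤ v)
  rw [Nat.card_Ico] at h1
  rw [← Nat.cast_sub hab]
  exact_mod_cast h1

theorem sum_log_lik (x : ℕ → ℝ) (v q : ℝ) {a b : ℕ} (hab : a ≤ b) :
    ∑ i ∈ Finset.Ico a b, Real.log (lik x v q i) = ((b : ℝ) - a) *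
      (empCDF x a b v * Real.log q + (1 - empCDF x a b v) * Real.log (1 - q)) := by
  have h : ∀ i, Real.log (lik x v q i) = if x i ≤ v then Real.log q else Real.log (1 - q) := by
    intro i; unfold lik; split_ifs <;> rfl
  simp_rw [h]
  rw [Finset.sum_ite, Finset.sum_const, Finset.sum_const, nsmul_eq_mul, nsmul_eq_mul,
    ← empCDF_mul_length x v hab, card_filter_not_le x v hab]
  ring

theorem exists_le_of_empCDF_ne_zero {x : ℕ → ℝ} {v : ℝ} {a b : ℕ} (h : empCDF x a b v ≠ 0) :
    ∃ i ∈ Finset.Ico a b, x i ≤ v := by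
  by_contra! hc
  apply h
  unfold empCDF
  rw [Finset.filter_false_of_mem (fun i hi => not_le.2 (hc i hi))]
  simp

theorem exists_lt_of_empCDF_ne_one {x : ℕ → ℝ} {v : ℝ} {a b : ℕ} (hab : a < b)
    (h : empCDF x a b v ≠ 1) : ∃ i ∈ Finset.Ico a b, ¬ x i ≤ v := by
  by_contra! hc
  apply h
  unfold empCDF
  rw [Finset.filter_true_of_mem hc, Nat.card_Ico, Nat.cast_sub hab.le, div_self]
  have : (a : ℝ) < b := by exact_mod_cast hab
  linarith

/-- The Gibbs inequality for a segment, with a Hellinger remainder. -/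
theorem sum_log_lik_add_hell_le {x : ℕ → ℝ} {v q : ℝ} {a b : ℕ} (hab : a ≤ b)
    (hq : q ∈ Set.Icc (0 : ℝ) 1) (hpos : ∀ i ∈ Finset.Ico a b, 0 < lik x v q i) :
    ∑ i ∈ Finset.Ico a b, Real.log (lik x v q i) + ((b : ℝ) - a) * hell (empCDF x a b v) q
      ≤ segLL x v a b := by
  rcases hab.eq_or_lt with rfl | hlt
  · simp [segLL]
  rw [sum_log_lik x v q hab, segLL, ← mul_add]
  refine mul_le_mul_of_nonneg_left ?_ (sub_nonneg.2 (by exact_mod_cast hab))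
  refine gibbs_hell (empCDF_mem_Icc x v hab) hq (fun h => ?_) (fun h => ?_)
  · obtain ⟨i, hi, hx⟩ := exists_le_of_empCDF_ne_zero h
    have := hpos i hi
    rw [lik, if_pos hx] at this
    exact this.ne'
  · obtain ⟨i, hi, hx⟩ := exists_lt_of_empCDF_ne_one hlt h
    have := hpos i hi
    rw [lik, if_neg hx] at this
    intro e
    linarith

theorem segLL_eq_sum_log_lik (x : ℕ → ℝ) (v : ℝ) {a b : ℕ} (hab : a ≤ b) :
    segLL x v a b = ∑ i ∈ Finset.Ico a b, Real.log (lik x v (empCDF x a b v) i) := by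
  rw [sum_log_lik x v _ hab, segLL, bernoulliLogLik]

theorem lik_empCDF_pos (x : ℕ → ℝ) (v : ℝ) {a b i : ℕ} (hi : i ∈ Finset.Ico a b) :
    0 < lik x v (empCDF x a b v) i := by
  have hab : a < b := by rw [Finset.mem_Ico] at hi; omega
  have hpos : (0 : ℝ) < (b : ℝ) - a := sub_pos.2 (by exact_mod_cast hab)
  unfold lik
  split_ifs with h
  · refine div_pos ?_ hpos
    exact_mod_cast Finset.card_pos.2 ⟨i, Finset.mem_filter.2 ⟨hi, h⟩⟩
  · have h1 := card_filter_not_le x v hab.le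
    have h2 : (0 : ℝ) < (((Finset.Ico a b).filter fun i => ¬ x i ≤ v).card : ℝ) := by
      exact_mod_cast Finset.card_pos.2 ⟨i, Finset.mem_filter.2 ⟨hi, h⟩⟩
    rw [h1] at h2
    exact (mul_pos_iff_of_pos_left hpos).1 h2

/-- Splitting a segment increases the maximal log-likelihood, at least by Hellinger distances. -/
theorem segLL_add_hell_le (x : ℕ → ℝ) (v : ℝ) {a m b : ℕ} (ham : a ≤ m) (hmb : m ≤ b) :
    segLL x v a b + ((m : ℝ) - a) * hell (empCDF x a m v) (empCDF x a b v) +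
      ((b : ℝ) - m) * hell (empCDF x m b v) (empCDF x a b v) ≤ segLL x v a m + segLL x v m b := by
  have hq := empCDF_mem_Icc x v (ham.trans hmb)
  have h1 := sum_log_lik_add_hell_le (x := x) (v := v) ham hq fun i hi =>
    lik_empCDF_pos x v (Finset.Ico_subset_Ico_right hmb hi)
  have h2 := sum_log_lik_add_hell_le (x := x) (v := v) hmb hq fun i hi =>
    lik_empCDF_pos x v (Finset.Ico_subset_Ico_left ham hi)
  rw [segLL_eq_sum_log_lik x v (ham.trans hmb), ← Finset.sum_Ico_consecutive _ ham hmb]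
  linarith

theorem segLL_le_add (x : ℕ → ℝ) (v : ℝ) {a m b : ℕ} (ham : a ≤ m) (hmb : m ≤ b) :
    segLL x v a b ≤ segLL x v a m + segLL x v m b := by
  have h := segLL_add_hell_le x v ham hmb
  have h1 : (0 : ℝ) ≤ (m : ℝ) - a := sub_nonneg.2 (by exact_mod_cast ham)
  have h2 : (0 : ℝ) ≤ (b : ℝ) - m := sub_nonneg.2 (by exact_mod_cast hmb)
  have := mul_nonneg h1 (hell_nonneg (empCDF x a m v) (empCDF x a b v))
  have := mul_nonneg h2 (hell_nonneg (empCDF x m b v) (empCDF x a b v))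
  linarith

/-! ### Sums along a monotone sequence of cuts -/

theorem le_sum_of_le_add {f : ℕ → ℕ → ℝ} (h0 : ∀ a, f a a ≤ 0)
    (hf : ∀ a b c, a ≤ b → b ≤ c → f a c ≤ f a b + f b c) :
    ∀ {M : ℕ} (s : Fin (M + 1) → ℕ), Monotone s →
      f (s 0) (s (Fin.last M)) ≤ ∑ r : Fin M, f (s r.castSucc) (s r.succ)
  | 0, s, _ => by simpa using h0 (s 0)
  | M + 1, s, hs => by
    have ih := le_sum_of_le_add h0 hf (fun r : Fin (M + 1) => s r.castSucc)
      (fun i j hij => hs (by simpa using hij))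
    rw [Fin.sum_univ_castSucc]
    have h1 := hf (s 0) (s (Fin.last M).castSucc) (s (Fin.last (M + 1)))
      (hs (Fin.zero_le _)) (hs (Fin.le_last _))
    simp only [Fin.castSucc_zero, Fin.succ_last] at *
    simp only [Fin.succ_castSucc] at *
    linarith

theorem sum_sum_Ico {M : ℕ} (f : ℕ → ℝ) (s : Fin (M + 1) → ℕ) (hs : Monotone s) :
    ∑ r : Fin M, ∑ i ∈ Finset.Ico (s r.castSucc) (s r.succ), f i
      = ∑ i ∈ Finset.Ico (s 0) (s (Fin.last M)), f i := by
  induction M with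
  | zero => simp
  | succ M ih =>
    have h := ih (fun r : Fin (M + 1) => s r.castSucc) (fun i j hij => hs (by simpa using hij))
    rw [Fin.sum_univ_castSucc]
    simp only [Fin.castSucc_zero, Fin.succ_last] at *
    simp only [Fin.succ_castSucc] at *
    rw [h, Finset.sum_Ico_consecutive _ (hs (Fin.zero_le _)) (hs (Fin.le_last _))]

/-! ### Samples that fit the model at a level -/

/-- At the level `v`, on every subsegment of a true segment `k`, the maximal likelihood is at most
`exp D` times the likelihood at `q k`. -/
def Fits (x : ℕ → ℝ) (v : ℝ) {K : ℕ} (τ : Fin (K + 2) → ℕ) (q : Fin (K + 1) → ℝ) (D : ℝ) : Prop :=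
  ∀ (k : Fin (K + 1)) (a b : ℕ), τ k.castSucc ≤ a → a < b → b ≤ τ k.succ →
    Real.exp (segLL x v a b) ≤ Real.exp D * ∏ i ∈ Finset.Ico a b, lik x v (q k) i

section Fits

variable {x : ℕ → ℝ} {v : ℝ} {K : ℕ} {τ : Fin (K + 2) → ℕ} {q : Fin (K + 1) → ℝ} {D : ℝ}

/-- The exponential form of `Fits` forces this: a zero factor would bound a positive exponential by
0. A logarithmic form would miss it, since `Real.log 0 = 0`. -/
theorem Fits.lik_pos (h : Fits x v τ q D) (hq : ∀ k, q k ∈ Set.Icc (0 : ℝ) 1)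
    {k : Fin (K + 1)} {a b : ℕ} (ha : τ k.castSucc ≤ a) (hb : b ≤ τ k.succ)
    {i : ℕ} (hi : i ∈ Finset.Ico a b) : 0 < lik x v (q k) i := by
  rcases (lik_nonneg x v (hq k) i).eq_or_lt with h0 | h0
  · exfalso
    have h1 := h k a b ha (by rw [Finset.mem_Ico] at hi; omega) hb
    rw [Finset.prod_eq_zero hi h0.symm, mul_zero] at h1
    exact absurd h1 (not_le.2 (Real.exp_pos _))
  · exact h0

theorem Fits.segLL_le (h : Fits x v τ q D) (hq : ∀ k, q k ∈ Set.Icc (0 : ℝ) 1)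
    {k : Fin (K + 1)} {a b : ℕ} (ha : τ k.castSucc ≤ a) (hab : a < b) (hb : b ≤ τ k.succ) :
    segLL x v a b ≤ ∑ i ∈ Finset.Ico a b, Real.log (lik x v (q k) i) + D := by
  have h1 := h k a b ha hab hb
  have hp : ∀ i ∈ Finset.Ico a b, 0 < lik x v (q k) i := fun i hi => h.lik_pos hq ha hb hi
  have h2 := Real.log_le_log (Real.exp_pos _) h1
  rw [Real.log_exp, Real.log_mul (Real.exp_pos _).ne' (Finset.prod_pos hp).ne', Real.log_exp,
    Real.log_prod (fun i hi => (hp i hi).ne')] at h2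
  linarith

/-- `segLL` is bounded above by `Fits` and below by Gibbs' inequality with remainder. What is left
is a concentration bound for empirical frequencies, uniform over subintervals. -/
theorem Fits.hell_le (h : Fits x v τ q D) (hq : ∀ k, q k ∈ Set.Icc (0 : ℝ) 1)
    {k : Fin (K + 1)} {a b : ℕ} (ha : τ k.castSucc ≤ a) (hab : a < b) (hb : b ≤ τ k.succ) :
    ((b : ℝ) - a) * hell (empCDF x a b v) (q k) ≤ D := by
  have h1 := h.segLL_le hq ha hab hb
  have h2 := sum_log_lik_add_hell_le hab.le (hq k) (fun i hi => h.lik_pos hq ha hb hi)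
  linarith

end Fits

/-- Log-likelihood of the indicator `1{x i ≤ v}` when its success probability is `q k` for all `i`
in the `k`-th segment. -/
noncomputable def modelLogLik (x : ℕ → ℝ) (v : ℝ) {K : ℕ} (τ : Fin (K + 2) → ℕ)
    (q : Fin (K + 1) → ℝ) (i : ℕ) : ℝ :=
  ∑ k : Fin (K + 1), if τ k.castSucc ≤ i ∧ i < τ k.succ then Real.log (lik x v (q k) i) else 0

theorem segment_unique {K : ℕ} {τ : Fin (K + 2) → ℕ} (hτ : Monotone τ) {i : ℕ}
    {k k' : Fin (K + 1)} (h1 : τ k.castSucc ≤ i) (h2 : i < τ k.succ)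
    (h3 : τ k'.castSucc ≤ i) (h4 : i < τ k'.succ) : k' = k := by
  by_contra hne
  rcases lt_or_gt_of_ne hne with h | h
  · have := hτ (show k'.succ ≤ k.castSucc from h)
    omega
  · have := hτ (show k.succ ≤ k'.castSucc from h)
    omega

theorem modelLogLik_eq {x : ℕ → ℝ} {v : ℝ} {K : ℕ} {τ : Fin (K + 2) → ℕ} (hτ : Monotone τ)
    {q : Fin (K + 1) → ℝ} {k : Fin (K + 1)} {i : ℕ} (h1 : τ k.castSucc ≤ i) (h2 : i < τ k.succ) :
    modelLogLik x v τ q i = Real.log (lik x v (q k) i) := by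
  unfold modelLogLik
  rw [Finset.sum_eq_single k, if_pos ⟨h1, h2⟩]
  · intro k' _ hk'
    exact if_neg fun h => hk' (segment_unique hτ h1 h2 h.1 h.2)
  · simp

/-! ### The partition of the sample into pieces around the change-points -/

/-- The end points of pieces that contain one change-point each: the midpoints of the inner
segments, and the two ends of the sample. -/
def pieceCut {K : ℕ} (τ : Fin (K + 2) → ℕ) (r : Fin (K + 1)) : ℕ :=
  if r = 0 then τ 0 else if r = Fin.last K then τ (Fin.last (K + 1))
    else (τ r.castSucc + τ r.succ) / 2

section pieceCut

variable {K : ℕ} {τ : Fin (K + 2) → ℕ}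

@[simp] theorem pieceCut_zero : pieceCut τ 0 = τ 0 := if_pos rfl

theorem pieceCut_last (hK : 1 ≤ K) : pieceCut τ (Fin.last K) = τ (Fin.last (K + 1)) := by
  unfold pieceCut
  rw [if_neg, if_pos rfl]
  intro h
  have := congrArg Fin.val h
  simp at this
  omega

theorem le_pieceCut (hτ : Monotone τ) (r : Fin (K + 1)) : τ r.castSucc ≤ pieceCut τ r := by
  have h := hτ (Fin.castSucc_le_succ r)
  unfold pieceCut
  split_ifs with h0 h1
  · subst h0; exact le_rfl
  · exact hτ (Fin.le_last _)
  · omega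

theorem pieceCut_le (hτ : Monotone τ) (r : Fin (K + 1)) : pieceCut τ r ≤ τ r.succ := by
  have h := hτ (Fin.castSucc_le_succ r)
  unfold pieceCut
  split_ifs with h0 h1
  · exact hτ (Fin.zero_le _)
  · subst h1; exact le_rfl
  · omega

theorem pieceCut_monotone (hτ : Monotone τ) : Monotone (pieceCut τ) := by
  refine Fin.monotone_iff_le_succ.2 fun r => ?_
  have h1 := pieceCut_le hτ r.castSucc
  have h2 := le_pieceCut hτ r.succ
  rw [Fin.succ_castSucc] at h1
  exact h1.trans h2

theorem left_length_pieceCut {lam : ℝ} (hl : 2 ≤ lam)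
    (hlam : ∀ k : Fin (K + 1), lam ≤ (τ k.succ : ℝ) - τ k.castSucc) (r : Fin K) :
    lam / 4 ≤ (τ r.succ.castSucc : ℝ) - pieceCut τ r.castSucc := by
  have h := hlam r.castSucc
  rw [Fin.succ_castSucc] at h
  unfold pieceCut
  split_ifs with h0 h1
  · have e : (r.castSucc.castSucc : Fin (K + 2)) = 0 := by rw [h0]; rfl
    rw [e] at h
    linarith
  · exact absurd h1 (Fin.castSucc_lt_last r).ne
  · rw [Fin.succ_castSucc]
    have := Nat.cast_div_le (α := ℝ) (m := τ r.castSucc.castSucc + τ r.succ.castSucc) (n := 2)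
    push_cast at this ⊢
    linarith

/-- Rounding the midpoint down costs at most 1/2 on this side, and lam / 2 - 1 / 2 ≥ lam / 4 because
lam ≥ 2. -/
theorem right_length_pieceCut {lam : ℝ} (hl : 2 ≤ lam)
    (hlam : ∀ k : Fin (K + 1), lam ≤ (τ k.succ : ℝ) - τ k.castSucc) (r : Fin K) :
    lam / 4 ≤ (pieceCut τ r.succ : ℝ) - τ r.succ.castSucc := by
  have h := hlam r.succ
  unfold pieceCut
  split_ifs with h0 h1
  · exact absurd h0 (Fin.succ_ne_zero r)
  · have e : (r.succ.succ : Fin (K + 2)) = Fin.last (K + 1) := by rw [h1]; rfl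
    rw [e] at h
    linarith
  · have h2 : τ r.succ.castSucc + τ r.succ.succ ≤ 2 * ((τ r.succ.castSucc + τ r.succ.succ) / 2) + 1 :=
      by omega
    have h3 : (τ r.succ.castSucc : ℝ) + τ r.succ.succ ≤
        2 * (((τ r.succ.castSucc + τ r.succ.succ) / 2 : ℕ) : ℝ) + 1 := by exact_mod_cast h2
    linarith

/-- The pieces that lie within one segment of `t`. -/
def uncut (τ : Fin (K + 2) → ℕ) {L : ℕ} (t : Fin (L + 2) → ℕ) (r : Fin K) : Prop :=
  ∃ k : Fin (L + 1), t k.castSucc ≤ pieceCut τ r.castSucc ∧ pieceCut τ r.succ ≤ t k.succ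

open Classical in
/-- With `L` change-points at least `K - L` pieces are uncut. -/
theorem le_card_uncut_add {n L : ℕ} (hτ : IsSegmentation n K τ) {t : Fin (L + 2) → ℕ}
    (ht : IsSegmentation n L t) :
    K ≤ (Finset.univ.filter fun r : Fin K => uncut τ t r).card + L := by
  rcases Nat.eq_zero_or_pos K with rfl | hK
  · simp
  have hmon := pieceCut_monotone hτ.1.monotone
  -- Let k be the last index whose cut lies at or before the start of the piece. If the piece is not
  -- uncut, the next cut falls strictly inside it. Interiors of distinct pieces are disjoint, so at
  -- most L pieces are cut.
  have hex : ∀ r : Fin K, ¬ uncut τ t r → ∃ k : Fin L,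
      pieceCut τ r.castSucc < t k.succ.castSucc ∧ t k.succ.castSucc < pieceCut τ r.succ := by
    intro r hr
    have hlo : 1 ≤ pieceCut τ r.castSucc := by
      have := hmon (Fin.zero_le r.castSucc)
      rw [pieceCut_zero, hτ.2.1] at this
      exact this
    have hhi : pieceCut τ r.succ ≤ n + 1 := by
      have := hmon (Fin.le_last r.succ)
      rw [pieceCut_last hK, hτ.2.2] at this
      exact this
    let A : Finset (Fin (L + 1)) :=
      Finset.univ.filter fun k => t k.castSucc ≤ pieceCut τ r.castSucc
    have hA : A.Nonempty := ⟨0, by simp [A, ht.2.1, hlo]⟩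
    obtain ⟨k, hkA, hkmax⟩ := A.exists_maximal hA
    have hk : t k.castSucc ≤ pieceCut τ r.castSucc := by simpa [A] using hkA
    have hlt : t k.succ < pieceCut τ r.succ := by
      by_contra hc
      exact hr ⟨k, hk, not_lt.1 hc⟩
    have hkl : k ≠ Fin.last L := by
      rintro rfl
      rw [Fin.succ_last, ht.2.2] at hlt
      omega
    obtain ⟨j, rfl⟩ : ∃ j : Fin L, j.castSucc = k := ⟨k.castPred hkl, by simp⟩
    refine ⟨j, ?_, by rwa [Fin.succ_castSucc] at hlt⟩
    by_contra hc
    have hmem : j.succ ∈ A := by simpa [A] using not_lt.1 hc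
    have := hkmax hmem (Fin.castSucc_lt_succ (i := j)).le
    exact absurd this (not_le.2 (Fin.castSucc_lt_succ (i := j)))
  have hcard : (Finset.univ.filter fun r : Fin K => ¬ uncut τ t r).card ≤
      (Finset.univ : Finset (Fin L)).card := by
    rcases isEmpty_or_nonempty (Fin L) with hL | hL
    · rw [Finset.filter_false_of_mem]
      · simp
      · intro r _ hr
        exact hL.elim (hex r hr).choose
    choose! f hf using hex
    refine Finset.card_le_card_of_injOn f (fun _ _ => Finset.mem_coe.2 (Finset.mem_univ _)) ?_
    intro r hr r' hr' hrr
    have h1 := hf r (by simpa using hr)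
    have h2 := hf r' (by simpa using hr')
    rw [← hrr] at h2
    by_contra hne
    rcases lt_or_gt_of_ne hne with h | h
    · have := hmon (show r.succ ≤ r'.castSucc from h)
      omega
    · have := hmon (show r'.succ ≤ r.castSucc from h)
      omega
  have h := Finset.card_filter_add_card_filter_not (s := (Finset.univ : Finset (Fin K)))
    (fun r => uncut τ t r)
  simp only [Finset.card_univ, Fintype.card_fin] at h hcard
  omega

end pieceCut

/-! ### Comparison of a segmentation with the true one at a fixed level -/

section Comparison

variable {x : ℕ → ℝ} {v : ℝ} {n K : ℕ} {τ : Fin (K + 2) → ℕ} {q : Fin (K + 1) → ℝ} {D : ℝ}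

theorem Fits.segLL_le_modelLogLik (h : Fits x v τ q D) (hτ : Monotone τ)
    (hq : ∀ k, q k ∈ Set.Icc (0 : ℝ) 1) (hD : 0 ≤ D)
    {k : Fin (K + 1)} {a b : ℕ} (ha : τ k.castSucc ≤ a) (hab : a ≤ b) (hb : b ≤ τ k.succ) :
    segLL x v a b ≤ ∑ i ∈ Finset.Ico a b, modelLogLik x v τ q i + D := by
  rcases hab.eq_or_lt with rfl | hlt
  · simpa [segLL_self] using hD
  refine (h.segLL_le hq ha hlt hb).trans_eq ?_
  congr 1
  refine Finset.sum_congr rfl fun i hi => ?_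
  rw [Finset.mem_Ico] at hi
  exact (modelLogLik_eq hτ (by omega) (by omega)).symm

theorem Fits.modelLogLik_le_segLL (h : Fits x v τ q D) (hτ : Monotone τ)
    (hq : ∀ k, q k ∈ Set.Icc (0 : ℝ) 1) (k : Fin (K + 1)) :
    ∑ i ∈ Finset.Ico (τ k.castSucc) (τ k.succ), modelLogLik x v τ q i
      ≤ segLL x v (τ k.castSucc) (τ k.succ) := by
  have hle := hτ (Fin.castSucc_le_succ k)
  have h1 := sum_log_lik_add_hell_le hle (hq k) (fun i hi => h.lik_pos hq le_rfl le_rfl hi)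
  have h2 := mul_nonneg (sub_nonneg.2 (Nat.cast_le (α := ℝ).2 hle))
    (hell_nonneg (empCDF x (τ k.castSucc) (τ k.succ) v) (q k))
  have h3 : ∑ i ∈ Finset.Ico (τ k.castSucc) (τ k.succ), modelLogLik x v τ q i =
      ∑ i ∈ Finset.Ico (τ k.castSucc) (τ k.succ), Real.log (lik x v (q k) i) :=
    Finset.sum_congr rfl fun i hi => by
      rw [Finset.mem_Ico] at hi
      exact modelLogLik_eq hτ hi.1 hi.2
  linarith

/-- The only true change-point inside a piece splits the interval into two parts, each within one
true segment and costing D. Clipping the change-point to [a, b] makes one part empty when it lies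
outside. -/
theorem Fits.segLL_le_of_subset_piece (h : Fits x v τ q D) (hτ : Monotone τ)
    (hq : ∀ k, q k ∈ Set.Icc (0 : ℝ) 1) (hD : 0 ≤ D)
    {r : Fin K} {a b : ℕ} (ha : pieceCut τ r.castSucc ≤ a) (hab : a ≤ b)
    (hb : b ≤ pieceCut τ r.succ) :
    segLL x v a b ≤ ∑ i ∈ Finset.Ico a b, modelLogLik x v τ q i + 2 * D := by
  have h1 := le_pieceCut hτ r.castSucc
  have h2 := pieceCut_le hτ r.succ
  have ham : a ≤ max a (min b (τ r.succ.castSucc)) := le_max_left _ _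
  have hmb : max a (min b (τ r.succ.castSucc)) ≤ b := by omega
  set m := max a (min b (τ r.succ.castSucc)) with hm
  have hs := segLL_le_add x v ham hmb
  rw [← Finset.sum_Ico_consecutive _ ham hmb]
  have l1 : segLL x v a m ≤ ∑ i ∈ Finset.Ico a m, modelLogLik x v τ q i + D := by
    rcases ham.eq_or_lt with e | hlt
    · rw [← e, segLL_self]; simpa using hD
    · exact h.segLL_le_modelLogLik hτ hq hD (k := r.castSucc) (by omega) ham
        (by rw [Fin.succ_castSucc]; omega)
  have l2 : segLL x v m b ≤ ∑ i ∈ Finset.Ico m b, modelLogLik x v τ q i + D := by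
    rcases hmb.eq_or_lt with e | hlt
    · rw [e, segLL_self]; simpa using hD
    · exact h.segLL_le_modelLogLik hτ hq hD (k := r.succ) (by omega) hmb (by omega)
  linarith

/-- Fitting one frequency across the change loses the two Hellinger terms of `segLL_add_hell_le`.
Triangle inequalities compare them with the true frequencies: 24 = 4 · 2 · 3, from the length lam /
4 and the factors 2 and 3. Replacing empirical by true frequencies costs D / 2 on each side, hence 3
* D instead of 2 * D. -/
theorem Fits.segLL_piece_le (h : Fits x v τ q D) (hτ : StrictMono τ)
    (hq : ∀ k, q k ∈ Set.Icc (0 : ℝ) 1) (hD : 0 ≤ D) {lam : ℝ} (hl : 2 ≤ lam)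
    (hlam : ∀ k : Fin (K + 1), lam ≤ (τ k.succ : ℝ) - τ k.castSucc) (r : Fin K) :
    segLL x v (pieceCut τ r.castSucc) (pieceCut τ r.succ) ≤
      ∑ i ∈ Finset.Ico (pieceCut τ r.castSucc) (pieceCut τ r.succ), modelLogLik x v τ q i + 3 * D
        - lam / 24 * hell (q r.castSucc) (q r.succ) := by
  have h1 := le_pieceCut hτ.monotone r.castSucc
  have h2 := pieceCut_le hτ.monotone r.succ
  have h3 := left_length_pieceCut hl hlam r
  have h4 := right_length_pieceCut hl hlam r
  set a := pieceCut τ r.castSucc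
  set b := pieceCut τ r.succ
  set m := τ r.succ.castSucc
  have ham : a < m := by
    have : (a : ℝ) < m := by linarith
    exact_mod_cast this
  have hmb : m < b := by
    have : (m : ℝ) < b := by linarith
    exact_mod_cast this
  have hem : m = τ r.castSucc.succ := by rw [Fin.succ_castSucc]
  have hs := segLL_add_hell_le x v ham.le hmb.le
  rw [← Finset.sum_Ico_consecutive _ ham.le hmb.le]
  have l1 := h.segLL_le_modelLogLik hτ.monotone hq hD (k := r.castSucc) h1 ham.le hem.le
  have l2 := h.segLL_le_modelLogLik hτ.monotone hq hD (k := r.succ) le_rfl hmb.le h2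
  have e1 := h.hell_le hq (k := r.castSucc) h1 ham hem.le
  have e2 := h.hell_le hq (k := r.succ) le_rfl hmb h2
  have t1 := hell_le_two_mul (empCDF x a m v) (empCDF x a b v) (empCDF x m b v)
  have t2 := hell_le_three_mul (q r.castSucc) (empCDF x a m v) (empCDF x m b v) (q r.succ)
  rw [hell_comm (empCDF x a b v)] at t1
  rw [hell_comm (q r.castSucc) (empCDF x a m v)] at t2
  have n1 := hell_nonneg (empCDF x a m v) (empCDF x a b v)
  have n2 := hell_nonneg (empCDF x m b v) (empCDF x a b v)
  have n3 := hell_nonneg (empCDF x a m v) (q r.castSucc)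
  have n4 := hell_nonneg (empCDF x m b v) (q r.succ)
  have g1 := mul_le_mul_of_nonneg_right h3 n1
  have g2 := mul_le_mul_of_nonneg_right h4 n2
  have g3 := mul_le_mul_of_nonneg_right h3 n3
  have g4 := mul_le_mul_of_nonneg_right h4 n4
  have g5 := mul_le_mul_of_nonneg_left t1 (show 0 ≤ lam / 8 by linarith)
  have g6 := mul_le_mul_of_nonneg_left t2 (show 0 ≤ lam / 24 by linarith)
  nlinarith

open Classical in
/-- The fitted log-likelihood of any segmentation, compared with that of the true one. -/
theorem Fits.sum_segLL_le (h : Fits x v τ q D) (hτ : IsSegmentation n K τ) (hK : 1 ≤ K)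
    (hq : ∀ k, q k ∈ Set.Icc (0 : ℝ) 1) (hD : 0 ≤ D) {lam : ℝ} (hl : 2 ≤ lam)
    (hlam : ∀ k : Fin (K + 1), lam ≤ (τ k.succ : ℝ) - τ k.castSucc)
    {L : ℕ} {t : Fin (L + 2) → ℕ} (ht : IsSegmentation n L t) :
    ∑ k : Fin (L + 1), segLL x v (t k.castSucc) (t k.succ) ≤
      ∑ k : Fin (K + 1), segLL x v (τ k.castSucc) (τ k.succ) + 3 * D * ((L + 1) * K)
        - lam / 24 * ∑ r ∈ Finset.univ.filter (fun r : Fin K => uncut τ t r),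
            hell (q r.castSucc) (q r.succ) := by
  have hmon := hτ.1.monotone
  have htmon := ht.1.monotone
  have hsmon := pieceCut_monotone hmon
  set G : Fin K → ℝ := fun r => lam / 24 * hell (q r.castSucc) (q r.succ) with hG
  have hG0 : ∀ r, 0 ≤ G r := fun r => mul_nonneg (by linarith) (hell_nonneg _ _)
  let inn : Fin (L + 1) → Fin K → Prop := fun k r =>
    t k.castSucc ≤ pieceCut τ r.castSucc ∧ pieceCut τ r.succ ≤ t k.succ
  -- The piece end points clipped to the k-th segment of t: they refine that segment, and every bit
  -- lies within one piece, possibly being empty.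
  let cut : Fin (L + 1) → Fin (K + 1) → ℕ := fun k r =>
    max (t k.castSucc) (min (t k.succ) (pieceCut τ r))
  have hcutmon : ∀ k, Monotone (cut k) := fun k r r' hr => by
    have := hsmon hr
    simp only [cut]
    omega
  have hbd : ∀ k, 1 ≤ t k ∧ t k ≤ n + 1 := fun k => by
    have h1 := htmon (Fin.zero_le k)
    have h2 := htmon (Fin.le_last k)
    rw [ht.2.1] at h1
    rw [ht.2.2] at h2
    exact ⟨h1, h2⟩
  have hcut0 : ∀ k, cut k 0 = t k.castSucc := fun k => by
    have := hbd k.castSucc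
    simp only [cut, pieceCut_zero, hτ.2.1]
    omega
  have hcutl : ∀ k, cut k (Fin.last K) = t k.succ := fun k => by
    have h1 := hbd k.succ
    have h2 := htmon (Fin.castSucc_le_succ k)
    simp only [cut, pieceCut_last hK, hτ.2.2]
    omega
  have hkr : ∀ k r, segLL x v (cut k r.castSucc) (cut k r.succ) ≤
      ∑ i ∈ Finset.Ico (cut k r.castSucc) (cut k r.succ), modelLogLik x v τ q i + 3 * D
        - if inn k r then G r else 0 := by
    intro k r
    have hle : cut k r.castSucc ≤ cut k r.succ := hcutmon k (Fin.castSucc_le_succ r)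
    have hsle := hsmon (Fin.castSucc_le_succ r)
    split_ifs with hin
    · have e1 : cut k r.castSucc = pieceCut τ r.castSucc := by
        have := hin.1; have := hin.2
        simp only [cut]; omega
      have e2 : cut k r.succ = pieceCut τ r.succ := by
        have := hin.1; have := hin.2
        simp only [cut]; omega
      rw [e1, e2]
      exact h.segLL_piece_le hτ.1 hq hD hl hlam r
    · rcases hle.eq_or_lt with e | hlt
      · rw [e, segLL_self]
        simpa using hD
      · have := h.segLL_le_of_subset_piece hmon hq hD (r := r) (a := cut k r.castSucc)
          (b := cut k r.succ) (by simp only [cut] at hlt ⊢; omega) hle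
          (by simp only [cut] at hlt ⊢; omega)
        linarith
  have hk : ∀ k, segLL x v (t k.castSucc) (t k.succ) ≤
      ∑ i ∈ Finset.Ico (t k.castSucc) (t k.succ), modelLogLik x v τ q i + 3 * D * K
        - ∑ r, if inn k r then G r else 0 := by
    intro k
    have h1 := le_sum_of_le_add (f := segLL x v) (fun a => (segLL_self x v a).le)
      (fun a b c hab hbc => segLL_le_add x v hab hbc) (cut k) (hcutmon k)
    have h2 := sum_sum_Ico (modelLogLik x v τ q) (cut k) (hcutmon k)
    have h3 := Finset.sum_le_sum (s := Finset.univ) fun r _ => hkr k r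
    rw [Finset.sum_sub_distrib, Finset.sum_add_distrib, h2] at h3
    rw [hcut0, hcutl] at h1 h3
    simp only [Finset.sum_const, Finset.card_univ, Fintype.card_fin, nsmul_eq_mul] at h3
    linarith
  have h1 := Finset.sum_le_sum (s := Finset.univ) fun k _ => hk k
  rw [Finset.sum_sub_distrib, Finset.sum_add_distrib, sum_sum_Ico _ t htmon, ht.2.1, ht.2.2,
    Finset.sum_comm (f := fun k r => if inn k r then G r else 0)] at h1
  simp only [Finset.sum_const, Finset.card_univ, Fintype.card_fin, nsmul_eq_mul] at h1
  have h2 := Finset.sum_le_sum (s := Finset.univ) fun k (_ : k ∈ Finset.univ) =>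
    h.modelLogLik_le_segLL hmon hq k
  rw [sum_sum_Ico _ τ hmon, hτ.2.1, hτ.2.2] at h2
  -- An uncut piece lies in at least one segment of t. Since `G` is nonnegative, it is not necessary
  -- to know that this segment is unique.
  have h3 : ∑ r ∈ Finset.univ.filter (fun r : Fin K => uncut τ t r), G r ≤
      ∑ r : Fin K, ∑ k : Fin (L + 1), if inn k r then G r else 0 := by
    rw [Finset.sum_filter]
    refine Finset.sum_le_sum fun r _ => ?_
    have hnn : ∀ k ∈ (Finset.univ : Finset (Fin (L + 1))), 0 ≤ if inn k r then G r else 0 :=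
      fun k _ => by split_ifs <;> simp [hG0]
    split_ifs with hu
    · obtain ⟨k, hk⟩ := hu
      refine le_trans ?_ (Finset.single_le_sum hnn (Finset.mem_univ k))
      rw [if_pos hk]
    · exact Finset.sum_nonneg hnn
  rw [Finset.mul_sum]
  push_cast at h1
  linarith

end Comparison

/-! ### Order statistics -/

theorem sum_orderStat (n : ℕ) (x : ℕ → ℝ) (φ : ℝ → ℝ) :
    ∑ l ∈ Finset.Icc 1 n, φ (orderStat n x l) = ∑ i ∈ Finset.Icc 1 n, φ (x i) := by
  have h1 : ∀ f : ℕ → ℝ, ∑ l ∈ Finset.Icc 1 n, f l = ∑ j : Fin n, f (j + 1) := by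
    intro f
    rw [Fin.sum_univ_eq_sum_range (fun j => f (j + 1)) n, Finset.range_eq_Ico,
      Finset.sum_Ico_add' f 0 n 1]
    rfl
  rw [h1, h1]
  have h2 : ∀ j : Fin n, orderStat n x (j + 1) =
      x (((Tuple.sort fun i : Fin n => x ((i : ℕ) + 1)) j : ℕ) + 1) := by
    intro j
    rw [orderStat, dif_pos ⟨by omega, by omega⟩]
    congr
  simp_rw [h2]
  exact Equiv.sum_comp (Tuple.sort fun i : Fin n => x ((i : ℕ) + 1)) (fun i => φ (x (i + 1)))

theorem orderStat_mem {n : ℕ} (x : ℕ → ℝ) {l : ℕ} (h1 : 1 ≤ l) (h2 : l ≤ n) :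
    ∃ i ∈ Finset.Icc 1 n, orderStat n x l = x i := by
  rw [orderStat, dif_pos ⟨h1, h2⟩]
  refine ⟨_, ?_, rfl⟩
  rw [Finset.mem_Icc]
  constructor <;> omega

theorem card_le_orderStat {n : ℕ} {x : ℕ → ℝ} (hx : Set.InjOn x (Set.Icc 1 n)) {l : ℕ}
    (h1 : 1 ≤ l) (h2 : l ≤ n) :
    ((Finset.Ico 1 (n + 1)).filter fun i => x i ≤ orderStat n x l).card = l := by
  set f : Fin n → ℝ := fun i => x ((i : ℕ) + 1) with hf
  have hfinj : Function.Injective f := by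
    intro i j hij
    have := hx (show ((i : ℕ) + 1) ∈ Set.Icc 1 n from ⟨by omega, by omega⟩)
      (show ((j : ℕ) + 1) ∈ Set.Icc 1 n from ⟨by omega, by omega⟩) hij
    exact Fin.ext (by omega)
  set σ := Tuple.sort f with hσ
  have hsm : StrictMono (f ∘ σ) :=
    (Tuple.monotone_sort f).strictMono_of_injective (hfinj.comp σ.injective)
  have ho : orderStat n x l = f (σ ⟨l - 1, by omega⟩) := by
    rw [orderStat, dif_pos ⟨h1, h2⟩]
  rw [ho]
  have hcard : (Finset.univ.filter fun j : Fin n => j ≤ ⟨l - 1, by omega⟩).card = l := by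
    have : (Finset.univ.filter fun j : Fin n => j ≤ ⟨l - 1, by omega⟩) =
        Finset.Iic (⟨l - 1, by omega⟩ : Fin n) := by ext; simp
    rw [this, Fin.card_Iic]
    simp only
    omega
  refine Eq.trans ?_ hcard
  refine Finset.card_bij' (fun i hi => σ.symm ⟨i - 1, ?_⟩) (fun j _ => (σ j : ℕ) + 1) ?_ ?_ ?_ ?_
  · simp only [Finset.mem_filter, Finset.mem_Ico] at hi
    omega
  · intro i hi
    simp only [Finset.mem_filter, Finset.mem_Ico] at hi
    simp only [Finset.mem_filter, Finset.mem_univ, true_and]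
    rw [← hsm.le_iff_le]
    simp only [Function.comp, Equiv.apply_symm_apply]
    refine le_trans (le_of_eq ?_) hi.2
    change x (i - 1 + 1) = x i
    congr 1
    omega
  · intro j hj
    simp only [Finset.mem_filter, Finset.mem_univ, true_and] at hj
    simp only [Finset.mem_filter, Finset.mem_Ico]
    refine ⟨⟨by omega, by omega⟩, ?_⟩
    exact hsm.monotone hj
  · intro i hi
    simp only [Finset.mem_filter, Finset.mem_Ico] at hi
    simp only [Equiv.apply_symm_apply]
    omega
  · intro j _
    simp

/-! ### The weights of the order statistics -/

/-- The weight `n / (l (n - l))` of the `l`-th order statistic. -/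
noncomputable def weight (n l : ℕ) : ℝ := (n : ℝ) / ((l : ℝ) * ((n : ℝ) - (l : ℝ)))

theorem weight_nonneg {n l : ℕ} (h : l ≤ n) : 0 ≤ weight n l :=
  div_nonneg (Nat.cast_nonneg _)
    (mul_nonneg (Nat.cast_nonneg _) (sub_nonneg.2 (by exact_mod_cast h)))

theorem sum_inv_le {n : ℕ} {s : Finset ℕ} (hs : s ⊆ Finset.Icc 1 n) :
    ∑ l ∈ s, (l : ℝ)⁻¹ ≤ 1 + Real.log n := by
  have h := harmonic_le_one_add_log n
  rw [harmonic_eq_sum_Icc] at h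
  push_cast at h
  exact (Finset.sum_le_sum_of_subset_of_nonneg hs fun _ _ _ => by positivity).trans h

/-- Partial fractions: the weight is 1/l + 1/(n-l). Each harmonic sum is at most 1 + log n, and log
n ≥ 1 since n ≥ 3 > e. -/
theorem sum_weight_le {n : ℕ} (hn : 3 ≤ n) :
    ∑ l ∈ Finset.Icc 2 (n - 1), weight n l ≤ 4 * Real.log n := by
  have h1 : ∀ l ∈ Finset.Icc 2 (n - 1), weight n l = (l : ℝ)⁻¹ + ((n - l : ℕ) : ℝ)⁻¹ := by
    intro l hl
    rw [Finset.mem_Icc] at hl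
    have e : ((n - l : ℕ) : ℝ) = (n : ℝ) - l := Nat.cast_sub (by omega)
    have p1 : (0 : ℝ) < l := by exact_mod_cast (by omega : 0 < l)
    have p2 : (0 : ℝ) < (n : ℝ) - l := by
      rw [← e]; exact_mod_cast (by omega : 0 < n - l)
    rw [weight, e]
    field_simp
    ring
  rw [Finset.sum_congr rfl h1, Finset.sum_add_distrib]
  have a1 := sum_inv_le (n := n) (s := Finset.Icc 2 (n - 1))
    (fun l hl => by rw [Finset.mem_Icc] at *; omega)
  have a2 := sum_inv_le (n := n) (s := (Finset.Icc 2 (n - 1)).image fun l => n - l)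
    (fun l hl => by
      simp only [Finset.mem_image, Finset.mem_Icc] at *
      omega)
  rw [Finset.sum_image (fun i hi j hj hij => by
    simp only [Finset.coe_Icc, Set.mem_Icc] at hi hj hij
    omega)] at a2
  have a3 : 1 ≤ Real.log n := by
    rw [Real.le_log_iff_exp_le (by positivity)]
    have h3 : (3 : ℝ) ≤ n := by exact_mod_cast hn
    have := Real.exp_one_lt_d9
    linarith
  linarith

/-! ### The objective function -/

theorem Rn_eq_sum (n : ℕ) (x : ℕ → ℝ) {L : ℕ} (t : Fin (L + 2) → ℕ) :
    Rn n x t = ∑ l ∈ Finset.Icc 2 (n - 1),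
      weight n l * ∑ k : Fin (L + 1), segLL x (orderStat n x l) (t k.castSucc) (t k.succ) := by
  unfold Rn
  rw [Finset.sum_comm, Finset.mul_sum]
  refine Finset.sum_congr rfl fun l _ => ?_
  rw [Finset.mul_sum, Finset.mul_sum]
  refine Finset.sum_congr rfl fun k _ => ?_
  rw [weight, segLL]
  ring

theorem segLL_congr {n : ℕ} {x : ℕ → ℝ} {u v : ℝ}
    (h : ∀ i ∈ Finset.Icc 1 n, x i ≤ u ↔ x i ≤ v) {a b : ℕ} (ha : 1 ≤ a) (hb : b ≤ n + 1) :
    segLL x u a b = segLL x v a b := by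
  have e : (Finset.Ico a b).filter (fun i => x i ≤ u) =
      (Finset.Ico a b).filter (fun i => x i ≤ v) :=
    Finset.filter_congr fun i hi => h i (by rw [Finset.mem_Ico] at hi; rw [Finset.mem_Icc]; omega)
  rw [segLL, segLL, empCDF, empCDF, e]

theorem IsSegmentation.bounds {n L : ℕ} {t : Fin (L + 2) → ℕ} (ht : IsSegmentation n L t)
    (k : Fin (L + 2)) : 1 ≤ t k ∧ t k ≤ n + 1 := by
  have h1 := ht.1.monotone (Fin.zero_le k)
  have h2 := ht.1.monotone (Fin.le_last k)
  rw [ht.2.1] at h1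
  rw [ht.2.2] at h2
  exact ⟨h1, h2⟩

/-- The objective depends on a level only through the indicators it induces, so random order
statistics can be exchanged for levels from a fixed finite grid. -/
theorem Rn_eq_sum_of_equiv {n : ℕ} {x : ℕ → ℝ} {v : ℕ → ℝ}
    (h : ∀ l ∈ Finset.Icc 2 (n - 1), ∀ i ∈ Finset.Icc 1 n, x i ≤ orderStat n x l ↔ x i ≤ v l)
    {L : ℕ} {t : Fin (L + 2) → ℕ} (ht : IsSegmentation n L t) :
    Rn n x t = ∑ l ∈ Finset.Icc 2 (n - 1),
      weight n l * ∑ k : Fin (L + 1), segLL x (v l) (t k.castSucc) (t k.succ) := by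
  rw [Rn_eq_sum]
  refine Finset.sum_congr rfl fun l hl => ?_
  congr 1
  exact Finset.sum_congr rfl fun k _ => segLL_congr (h l hl) (ht.bounds _).1 (ht.bounds _).2

open Classical in
/-- The objective function at any segmentation, compared with its value at the true one. -/
theorem Rn_le {n K : ℕ} {x : ℕ → ℝ} {τ : Fin (K + 2) → ℕ} (hτ : IsSegmentation n K τ)
    (hn : 3 ≤ n) (hK : 1 ≤ K) {v : ℕ → ℝ} {q : ℕ → Fin (K + 1) → ℝ} {D κ lam : ℝ}
    (hq : ∀ l k, q l k ∈ Set.Icc (0 : ℝ) 1) (hD : 0 ≤ D) (hκ : 0 ≤ κ) (hl : 2 ≤ lam)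
    (hlam : ∀ k : Fin (K + 1), lam ≤ (τ k.succ : ℝ) - τ k.castSucc)
    (hv : ∀ l ∈ Finset.Icc 2 (n - 1), ∀ i ∈ Finset.Icc 1 n, x i ≤ orderStat n x l ↔ x i ≤ v l)
    (hfit : ∀ l ∈ Finset.Icc 2 (n - 1), Fits x (v l) τ (q l) D)
    (hsig : ∀ r : Fin K, κ ≤
      ∑ l ∈ Finset.Icc 2 (n - 1), weight n l * hell (q l r.castSucc) (q l r.succ))
    {L : ℕ} {t : Fin (L + 2) → ℕ} (ht : IsSegmentation n L t) :
    Rn n x t ≤ Rn n x τ + 12 * Real.log n * D * ((L + 1) * K) - lam / 24 * κ * (K - L : ℕ) := by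
  rw [Rn_eq_sum_of_equiv hv ht, Rn_eq_sum_of_equiv hv hτ]
  set U := Finset.univ.filter (fun r : Fin K => uncut τ t r) with hU
  have h1 : ∀ l ∈ Finset.Icc 2 (n - 1),
      weight n l * ∑ k : Fin (L + 1), segLL x (v l) (t k.castSucc) (t k.succ) ≤
      weight n l * ∑ k : Fin (K + 1), segLL x (v l) (τ k.castSucc) (τ k.succ) +
        weight n l * (3 * D * ((L + 1) * K)) -
        lam / 24 * ∑ r ∈ U, weight n l * hell (q l r.castSucc) (q l r.succ) := by
    intro l hl'
    have h2 := (hfit l hl').sum_segLL_le hτ hK (hq l) hD hl hlam ht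
    rw [Finset.mem_Icc] at hl'
    have h3 := mul_le_mul_of_nonneg_left h2 (weight_nonneg (n := n) (l := l) (by omega))
    rw [← Finset.mul_sum]
    linarith
  have h2 := Finset.sum_le_sum h1
  rw [Finset.sum_sub_distrib, Finset.sum_add_distrib, ← Finset.sum_mul, ← Finset.mul_sum,
    Finset.sum_comm] at h2
  have h3 : (U.card : ℝ) * κ ≤ ∑ r ∈ U, ∑ l ∈ Finset.Icc 2 (n - 1),
      weight n l * hell (q l r.castSucc) (q l r.succ) := by
    rw [← nsmul_eq_mul]
    exact Finset.card_nsmul_le_sum _ _ _ fun r _ => hsig r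
  -- The subtraction is truncated: for L ≥ K it is 0, so a single bound serves both under- and
  -- overestimation.
  have h4 : ((K - L : ℕ) : ℝ) ≤ U.card := by
    have h5 : K ≤ U.card + L := by convert le_card_uncut_add hτ ht
    exact_mod_cast (by omega : K - L ≤ U.card)
  have h5 := mul_le_mul_of_nonneg_right (sum_weight_le hn)
    (show 0 ≤ 3 * D * (((L : ℝ) + 1) * K) by positivity)
  have h6 := mul_le_mul_of_nonneg_left ((mul_le_mul_of_nonneg_right h4 hκ).trans h3)
    (show 0 ≤ lam / 24 by linarith)
  linarith

theorem exists_isSegmentation {n L : ℕ} (h : L < n) : ∃ t, IsSegmentation n L t := by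
  refine ⟨fun i => if i = Fin.last (L + 1) then n + 1 else i + 1, ?_, ?_, ?_⟩
  · refine Fin.strictMono_iff_lt_succ.2 fun i => ?_
    rw [if_neg (Fin.castSucc_lt_last i).ne]
    split_ifs with h1
    · simp only [Fin.val_castSucc]; omega
    · simp
  · have h0 : (0 : Fin (L + 2)) ≠ Fin.last (L + 1) := by
      intro e
      simpa using congrArg Fin.val e
    simp [h0]
  · simp

/-- Omitting d ≥ 1 change-points saves d ζ of penalty but loses at least 2 d ζ - ζ / 2 of fit. Each
superfluous one costs ζ, while the total gain in fit is at most ζ / 2. -/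
theorem eq_of_isBICMinimizer {n K Kbar k : ℕ} {x : ℕ → ℝ} {τ : Fin (K + 2) → ℕ}
    (hτ : IsSegmentation n K τ) (hK : 1 ≤ K) (hKbar : K ≤ Kbar) (hn : Kbar < n) {ζ : ℝ}
    (hζ : 0 < ζ)
    (hR : ∀ L ≤ Kbar, ∀ t : Fin (L + 2) → ℕ, IsSegmentation n L t →
      Rn n x t ≤ Rn n x τ + ζ / 2 - 2 * ζ * (K - L : ℕ))
    (hk : IsBICMinimizer n x ζ Kbar k) : k = K := by
  have hk1 := Finset.mem_Icc.1 hk.1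
  have h1 := hk.2 K (Finset.mem_Icc.2 ⟨hK, hKbar⟩)
  have h2 : Rn n x τ ≤ maxRn n x K := by
    refine le_csSup ⟨Rn n x τ + ζ / 2 - 2 * ζ * (K - K : ℕ), ?_⟩ ⟨τ, hτ, rfl⟩
    rintro y ⟨t, ht, rfl⟩
    exact hR K hKbar t ht
  have h3 : maxRn n x k ≤ Rn n x τ + ζ / 2 - 2 * ζ * (K - k : ℕ) := by
    -- A segmentation must exist here, because `sSup ∅ = 0` would make `maxRn` meaningless; this is
    -- the role of Kbar < n.
    obtain ⟨t, ht⟩ := exists_isSegmentation (hk1.2.trans_lt hn)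
    refine csSup_le ⟨_, t, ht, rfl⟩ ?_
    rintro y ⟨t, ht, rfl⟩
    exact hR k hk1.2 t ht
  unfold BIC at h1
  by_contra hne
  rcases lt_or_gt_of_ne hne with h | h
  · have e : ((K - k : ℕ) : ℝ) = (K : ℝ) - k := Nat.cast_sub h.le
    have h4 : (k : ℝ) + 1 ≤ K := by exact_mod_cast h
    rw [e] at h3
    nlinarith
  · have h4 : (K : ℝ) + 1 ≤ k := by exact_mod_cast h
    have e : ((K - k : ℕ) : ℝ) = 0 := by
      rw [Nat.sub_eq_zero_of_le h.le]; simp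
    rw [e] at h3
    nlinarith

/-! ### Continuous distribution functions -/

section ContinuousCDF

variable {μ : Measure ℝ}

/-- By continuity the sublevel set is a closed lower set, and the limits at ±∞ make it nonempty and
bounded above. Its supremum is the largest t-quantile. -/
theorem exists_setOf_cdf_le_eq_Iic (hc : Continuous (cdf μ)) {t : ℝ} (h0 : 0 < t) (h1 : t < 1) :
    ∃ u, {x | cdf μ x ≤ t} = Set.Iic u ∧ cdf μ u = t := by
  obtain ⟨a, ha⟩ := ((tendsto_cdf_atBot μ).eventually_lt_const h0).exists
  obtain ⟨b, hb⟩ := ((tendsto_cdf_atTop μ).eventually_const_lt h1).exists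
  have hne : {x | cdf μ x ≤ t}.Nonempty := ⟨a, ha.le⟩
  have hbdd : BddAbove {x | cdf μ x ≤ t} := ⟨b, fun x hx => by
    by_contra hc'
    exact absurd (monotone_cdf μ (not_le.1 hc').le) (not_le.2 (lt_of_le_of_lt hx hb))⟩
  have hcl : IsClosed {x | cdf μ x ≤ t} := isClosed_le hc continuous_const
  have hmem := hcl.csSup_mem hne hbdd
  have hset : {x | cdf μ x ≤ t} = Set.Iic (sSup {x | cdf μ x ≤ t}) := by
    ext x
    exact ⟨fun hx => le_csSup hbdd hx, fun hx => (monotone_cdf μ hx).trans hmem⟩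
  refine ⟨_, hset, le_antisymm hmem ?_⟩
  obtain ⟨y, hy⟩ := mem_range_of_exists_le_of_exists_ge hc ⟨a, ha.le⟩ ⟨b, hb.le⟩
  exact hy.ge.trans (monotone_cdf μ (le_csSup hbdd hy.le))

variable [IsProbabilityMeasure μ]

/-- The probability integral transform: a continuous distribution function of its own variable is
uniform. At t = 0 the sublevel set may be empty, so that value is obtained from small positive t. -/
theorem measureReal_cdf_le (hc : Continuous (cdf μ)) {t : ℝ} (h0 : 0 ≤ t) (h1 : t ≤ 1) :
    μ.real {x | cdf μ x ≤ t} = t := by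
  rcases h1.eq_or_lt with rfl | h1
  · have : {x | cdf μ x ≤ 1} = Set.univ := by ext x; simp [cdf_le_one]
    rw [this, probReal_univ]
  have key : ∀ s, 0 < s → s < 1 → μ.real {x | cdf μ x ≤ s} = s := by
    intro s hs0 hs1
    obtain ⟨u, hu, hu'⟩ := exists_setOf_cdf_le_eq_Iic hc hs0 hs1
    rw [hu, ← cdf_eq_real, hu']
  rcases h0.eq_or_lt with rfl | h0
  · refine le_antisymm (le_of_forall_pos_lt_add fun ε hε => ?_) measureReal_nonneg
    have hm : 0 < min (ε / 2) (1 / 2) := by positivity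
    have hm1 : min (ε / 2) (1 / 2) < 1 := (min_le_right _ _).trans_lt (by norm_num)
    have h2 : μ.real {x | cdf μ x ≤ 0} ≤ μ.real {x | cdf μ x ≤ min (ε / 2) (1 / 2)} :=
      measureReal_mono fun x hx => (show cdf μ x ≤ 0 from hx).trans hm.le
    rw [key _ hm hm1] at h2
    have := min_le_left (ε / 2) (1 / 2)
    linarith
  · exact key t h0 h1

theorem measureReal_lt_cdf (hc : Continuous (cdf μ)) {t : ℝ} (h0 : 0 ≤ t) (h1 : t ≤ 1) :
    μ.real {x | t < cdf μ x} = 1 - t := by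
  have h : {x | t < cdf μ x} = {x | cdf μ x ≤ t}ᶜ := by ext x; simp
  have hmeas : MeasurableSet {x | cdf μ x ≤ t} := measurableSet_le hc.measurable measurable_const
  rw [h, probReal_compl_eq_one_sub hmeas, measureReal_cdf_le hc h0 h1]

theorem measureReal_cdf_mem_Ioc (hc : Continuous (cdf μ)) {s t : ℝ} (h0 : 0 ≤ s) (hst : s ≤ t)
    (h1 : t ≤ 1) : μ.real {x | s < cdf μ x ∧ cdf μ x ≤ t} = t - s := by
  have h : {x | s < cdf μ x ∧ cdf μ x ≤ t} = {x | cdf μ x ≤ t} \ {x | cdf μ x ≤ s} := by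
    ext x; simp [and_comm]
  have hmeas : MeasurableSet {x | cdf μ x ≤ s} := measurableSet_le hc.measurable measurable_const
  have hsub : {x | cdf μ x ≤ s} ⊆ {x | cdf μ x ≤ t} := fun x hx => le_trans hx hst
  rw [h, measureReal_sdiff hsub hmeas, measureReal_cdf_le hc (h0.trans hst) h1,
    measureReal_cdf_le hc h0 (hst.trans h1)]

end ContinuousCDF

/-! ### The model -/

section Model

variable {Ω : Type*} [MeasurableSpace Ω] {P : Measure Ω}
  {n K : ℕ} {τ : Fin (K + 2) → ℕ} {ν : Fin (K + 1) → Measure ℝ} {X : ℕ → Ω → ℝ}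

theorem IsModel.measure_iInter (h : IsModel P n K τ ν X) {S : Finset ℕ}
    (hS : S ⊆ Finset.Icc 1 n) {sets : ℕ → Set ℝ} (hm : ∀ i, MeasurableSet (sets i)) :
    P (⋂ i ∈ S, X i ⁻¹' sets i) = ∏ i ∈ S, P (X i ⁻¹' sets i) := by
  have h1 := h.indep.measure_inter_preimage_eq_mul
    (S := S.subtype (· ∈ Finset.Icc 1 n)) (sets := fun i => sets i) (fun i _ => hm i)
  have h2 : (⋂ i ∈ S.subtype (· ∈ Finset.Icc 1 n), X (i : ℕ) ⁻¹' sets i) =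
      ⋂ i ∈ S, X i ⁻¹' sets i := by
    ext ω
    simp only [Finset.mem_subtype, Set.mem_iInter, Set.mem_preimage, Subtype.forall]
    exact ⟨fun H i hi => H i (hS hi) hi, fun H i _ hi => H i hi⟩
  rw [h2] at h1
  rw [h1]
  rw [Finset.prod_subtype_of_mem (fun i => P (X i ⁻¹' sets i)) (fun i hi => hS hi)]

variable [IsProbabilityMeasure P]

theorem IsModel.isProbabilityMeasure (h : IsModel P n K τ ν X) (k : Fin (K + 1)) :
    IsProbabilityMeasure (ν k) :=
  (h.law k _ le_rfl (h.segmentation.1 Fin.castSucc_lt_succ)).isProbabilityMeasure_iff.1 ‹_›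

theorem IsSegmentation.exists_segment {L : ℕ} {t : Fin (L + 2) → ℕ} (ht : IsSegmentation n L t)
    {i : ℕ} (h1 : 1 ≤ i) (h2 : i ≤ n) : ∃ k : Fin (L + 1), t k.castSucc ≤ i ∧ i < t k.succ := by
  let A : Finset (Fin (L + 1)) := Finset.univ.filter fun k => t k.castSucc ≤ i
  have hA : A.Nonempty := ⟨0, by simp [A, ht.2.1, h1]⟩
  obtain ⟨k, hkA, hkmax⟩ := A.exists_maximal hA
  refine ⟨k, by simpa [A] using hkA, ?_⟩
  by_contra hc
  have hkl : k ≠ Fin.last L := by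
    rintro rfl
    rw [Fin.succ_last, ht.2.2] at hc
    omega
  obtain ⟨j, rfl⟩ : ∃ j : Fin L, j.castSucc = k := ⟨k.castPred hkl, by simp⟩
  have hmem : j.succ ∈ A := by
    rw [Fin.succ_castSucc] at hc
    simpa [A] using hc
  exact absurd (hkmax hmem (Fin.castSucc_lt_succ (i := j)).le)
    (not_le.2 (Fin.castSucc_lt_succ (i := j)))

theorem sum_length_eq {L : ℕ} {t : Fin (L + 2) → ℕ} (ht : IsSegmentation n L t) :
    ∑ k : Fin (L + 1), ((t k.succ : ℝ) - t k.castSucc) = n := by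
  have h := sum_sum_Ico (fun _ => (1 : ℝ)) t ht.1.monotone
  simp only [Finset.sum_const, Nat.card_Ico, nsmul_eq_mul, mul_one, ht.2.1, ht.2.2] at h
  rw [Nat.add_sub_cancel] at h
  rw [← h]
  exact Finset.sum_congr rfl fun k _ =>
    (Nat.cast_sub (ht.1.monotone (Fin.castSucc_le_succ k))).symm

theorem IsSegmentation.length_nonneg {L : ℕ} {t : Fin (L + 2) → ℕ} (ht : IsSegmentation n L t)
    (k : Fin (L + 1)) : (1 : ℝ) ≤ (t k.succ : ℝ) - t k.castSucc := by
  have : t k.castSucc + 1 ≤ t k.succ := ht.1 Fin.castSucc_lt_succ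
  have : (t k.castSucc : ℝ) + 1 ≤ t k.succ := by exact_mod_cast this
  linarith

theorem IsModel.pooledLaw_real (h : IsModel P n K τ ν X) (s : Set ℝ) :
    (pooledLaw n τ ν).real s =
      ∑ k : Fin (K + 1), ((τ k.succ : ℝ) - τ k.castSucc) / n * (ν k).real s := by
  have := h.isProbabilityMeasure
  rw [pooledLaw, measureReal_def, Measure.finsetSum_apply, ENNReal.toReal_sum]
  · refine Finset.sum_congr rfl fun k _ => ?_
    rw [Measure.smul_apply, smul_eq_mul, ENNReal.toReal_mul, ENNReal.toReal_ofReal, measureReal_def]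
    have := h.segmentation.length_nonneg k
    positivity
  · intro k _
    rw [Measure.smul_apply, smul_eq_mul]
    exact ENNReal.mul_ne_top ENNReal.ofReal_ne_top (measure_ne_top _ _)

theorem IsModel.isProbabilityMeasure_pooledLaw (h : IsModel P n K τ ν X) (hn : 1 ≤ n) :
    IsProbabilityMeasure (pooledLaw n τ ν) := by
  have := h.isProbabilityMeasure
  have h1 := h.pooledLaw_real Set.univ
  simp only [probReal_univ, mul_one] at h1
  have hn' : (n : ℝ) ≠ 0 := by positivity
  rw [← Finset.sum_div, sum_length_eq h.segmentation, div_self hn'] at h1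
  refine ⟨?_⟩
  rw [measureReal_def] at h1
  rwa [← ENNReal.toReal_eq_one_iff]

theorem IsModel.cdf_pooledLaw (h : IsModel P n K τ ν X) (hn : 1 ≤ n) (u : ℝ) :
    cdf (pooledLaw n τ ν) u =
      ∑ k : Fin (K + 1), ((τ k.succ : ℝ) - τ k.castSucc) / n * cdf (ν k) u := by
  have := h.isProbabilityMeasure
  have := h.isProbabilityMeasure_pooledLaw hn
  simp_rw [cdf_eq_real]
  exact h.pooledLaw_real _

theorem IsModel.continuous_cdf_pooledLaw (h : IsModel P n K τ ν X) (hn : 1 ≤ n)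
    (hc : ∀ k, Continuous (cdf (ν k))) : Continuous (cdf (pooledLaw n τ ν)) := by
  have : (cdf (pooledLaw n τ ν) : ℝ → ℝ) = fun u =>
      ∑ k : Fin (K + 1), ((τ k.succ : ℝ) - τ k.castSucc) / n * cdf (ν k) u :=
    funext fun u => h.cdf_pooledLaw hn u
  rw [this]
  exact continuous_finsetSum _ fun k _ => continuous_const.mul (hc k)

/-- The pooled law is a mixture containing ν k with weight length / n. This is how statements about
F pass to a single segment or observation. -/
theorem IsModel.length_mul_le (h : IsModel P n K τ ν X) (hn : 1 ≤ n) (s : Set ℝ)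
    (k : Fin (K + 1)) :
    ((τ k.succ : ℝ) - τ k.castSucc) * (ν k).real s ≤ n * (pooledLaw n τ ν).real s := by
  have hn' : (0 : ℝ) < n := by positivity
  rw [h.pooledLaw_real s]
  have h1 := Finset.single_le_sum (s := Finset.univ)
    (f := fun k : Fin (K + 1) => ((τ k.succ : ℝ) - τ k.castSucc) / n * (ν k).real s)
    (fun k _ => by
      have := h.segmentation.length_nonneg k
      have : (0 : ℝ) ≤ (ν k).real s := measureReal_nonneg
      positivity) (Finset.mem_univ k)
  have h2 := mul_le_mul_of_nonneg_left h1 hn'.le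
  refine le_trans (le_of_eq ?_) h2
  field_simp

theorem IsModel.length_mul_cdf_sub_le (h : IsModel P n K τ ν X) (hn : 1 ≤ n) {u v : ℝ}
    (huv : u ≤ v) (k : Fin (K + 1)) :
    ((τ k.succ : ℝ) - τ k.castSucc) * (cdf (ν k) v - cdf (ν k) u) ≤
      n * (cdf (pooledLaw n τ ν) v - cdf (pooledLaw n τ ν) u) := by
  have := h.isProbabilityMeasure
  have := h.isProbabilityMeasure_pooledLaw hn
  have h1 := h.length_mul_le hn (Set.Iic v \ Set.Iic u) k
  rwa [measureReal_sdiff (Set.Iic_subset_Iic.2 huv) measurableSet_Iic,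
    measureReal_sdiff (Set.Iic_subset_Iic.2 huv) measurableSet_Iic,
    ← cdf_eq_real, ← cdf_eq_real, ← cdf_eq_real, ← cdf_eq_real] at h1

theorem cdf_mem_Icc (μ : Measure ℝ) (u : ℝ) : cdf μ u ∈ Set.Icc (0 : ℝ) 1 :=
  ⟨cdf_nonneg μ u, cdf_le_one μ u⟩

end Model

/-! ### Likelihood ratio deviations -/

theorem prod_ite_mem_filter {ι : Type*} (s : Finset ι) (p : ι → Prop) [DecidablePred p] (a b : ℝ) :
    ∏ i ∈ s, (if p i then a else b) =
      a ^ (s.filter p).card * b ^ (s.card - (s.filter p).card) := by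
  rw [Finset.prod_ite, Finset.prod_const, Finset.prod_const]
  congr 2
  have := Finset.card_filter_add_card_filter_not (s := s) p
  omega

theorem prod_lik (x : ℕ → ℝ) (v q : ℝ) (a b : ℕ) :
    ∏ i ∈ Finset.Ico a b, lik x v q i =
      q ^ ((Finset.Ico a b).filter fun i => x i ≤ v).card *
        (1 - q) ^ (b - a - ((Finset.Ico a b).filter fun i => x i ≤ v).card) := by
  unfold lik
  rw [prod_ite_mem_filter, Nat.card_Ico]

theorem exp_segLL (x : ℕ → ℝ) (v : ℝ) {a b : ℕ} (hab : a ≤ b) :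
    Real.exp (segLL x v a b) = ∏ i ∈ Finset.Ico a b, lik x v (empCDF x a b v) i := by
  rw [segLL_eq_sum_log_lik x v hab, Real.exp_sum]
  exact Finset.prod_congr rfl fun i hi => Real.exp_log (lik_empCDF_pos x v hi)

/-- The maximum of the Bernoulli likelihood for `s` successes in `m` trials. -/
noncomputable def maxLik (m s : ℕ) : ℝ :=
  ((s : ℝ) / m) ^ s * (1 - (s : ℝ) / m) ^ (m - s)

theorem maxLik_nonneg {m s : ℕ} (h : s ≤ m) : 0 ≤ maxLik m s := by
  have h1 : (s : ℝ) / m ≤ 1 := div_le_one_of_le₀ (by exact_mod_cast h) (Nat.cast_nonneg m)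
  have h2 : (0 : ℝ) ≤ 1 - (s : ℝ) / m := by linarith
  unfold maxLik
  positivity

/-- The left side is a binomial probability with success parameter s / m, hence one term of an
expansion of 1. -/
theorem choose_mul_maxLik_le {m s : ℕ} (h : s ≤ m) : (m.choose s : ℝ) * maxLik m s ≤ 1 := by
  have h1 : (s : ℝ) / m ≤ 1 := div_le_one_of_le₀ (by exact_mod_cast h) (Nat.cast_nonneg m)
  have h2 : (0 : ℝ) ≤ 1 - (s : ℝ) / m := by linarith
  have h3 := add_pow ((s : ℝ) / m) (1 - (s : ℝ) / m) m
  rw [add_sub_cancel, one_pow] at h3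
  rw [h3, maxLik, mul_comm]
  exact Finset.single_le_sum
    (f := fun k => ((s : ℝ) / m) ^ k * (1 - (s : ℝ) / m) ^ (m - k) * (m.choose k : ℝ))
    (fun k _ => by positivity) (Finset.mem_range.2 (by omega))

theorem sum_powerset_maxLik_le (I : Finset ℕ) :
    ∑ T ∈ I.powerset, maxLik I.card T.card ≤ I.card + 1 := by
  rw [Finset.sum_powerset_apply_card]
  refine (Finset.sum_le_card_nsmul _ _ 1 fun s hs => ?_).trans_eq ?_
  · rw [nsmul_eq_mul]
    exact choose_mul_maxLik_le (by rw [Finset.mem_range] at hs; omega)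
  · simp

section Model

variable {Ω : Type*} [MeasurableSpace Ω] {P : Measure Ω} [IsProbabilityMeasure P]
  {n K : ℕ} {τ : Fin (K + 2) → ℕ} {ν : Fin (K + 1) → Measure ℝ} {X : ℕ → Ω → ℝ}

theorem IsModel.measure_pattern (h : IsModel P n K τ ν X) {k : Fin (K + 1)} {a b : ℕ}
    (ha : τ k.castSucc ≤ a) (hb : b ≤ τ k.succ) (v : ℝ) {T : Finset ℕ}
    (hT : T ⊆ Finset.Ico a b) :
    P {ω | (Finset.Ico a b).filter (fun i => X i ω ≤ v) = T} ≤
      ENNReal.ofReal (cdf (ν k) v ^ T.card * (1 - cdf (ν k) v) ^ (b - a - T.card)) := by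
  have := h.isProbabilityMeasure k
  have hI : Finset.Ico a b ⊆ Finset.Icc 1 n := fun i hi => by
    have h1 := (h.segmentation.bounds k.castSucc).1
    have h2 := (h.segmentation.bounds k.succ).2
    rw [Finset.mem_Ico] at hi
    rw [Finset.mem_Icc]
    omega
  have hsub : {ω | (Finset.Ico a b).filter (fun i => X i ω ≤ v) = T} ⊆
      ⋂ i ∈ Finset.Ico a b, X i ⁻¹' (if i ∈ T then Set.Iic v else Set.Ioi v) := by
    intro ω hω
    simp only [Set.mem_iInter, Set.mem_preimage]
    intro i hi
    have hiff : i ∈ T ↔ X i ω ≤ v := by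
      rw [← (show (Finset.Ico a b).filter (fun i => X i ω ≤ v) = T from hω), Finset.mem_filter]
      exact and_iff_right hi
    split_ifs with hiT
    · exact hiff.1 hiT
    · exact not_le.1 fun hc => hiT (hiff.2 hc)
  refine (measure_mono hsub).trans ?_
  rw [h.measure_iInter hI (fun i => by split_ifs <;> measurability)]
  have hprod : ∏ i ∈ Finset.Ico a b, P (X i ⁻¹' (if i ∈ T then Set.Iic v else Set.Ioi v)) =
      ∏ i ∈ Finset.Ico a b, ENNReal.ofReal (if i ∈ T then cdf (ν k) v else 1 - cdf (ν k) v) := by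
    refine Finset.prod_congr rfl fun i hi => ?_
    rw [Finset.mem_Ico] at hi
    have hlaw := h.law k i (by omega) (by omega)
    split_ifs
    · rw [ofReal_cdf]
      exact hlaw.measure_eq (p := fun y => y ∈ Set.Iic v) measurableSet_Iic
    · rw [cdf_eq_real, ← probReal_compl_eq_one_sub measurableSet_Iic, Set.compl_Iic,
        ofReal_measureReal]
      exact hlaw.measure_eq (p := fun y => y ∈ Set.Ioi v) measurableSet_Ioi
  rw [hprod, ← ENNReal.ofReal_prod_of_nonneg, prod_ite_mem_filter, Nat.card_Ico,
    Finset.filter_mem_eq_inter, Finset.inter_eq_right.2 hT]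
  intro i _
  split_ifs
  · exact cdf_nonneg _ _
  · exact sub_nonneg.2 (cdf_le_one _ _)

/-- Sum over the violating patterns T: the probability of T is at most exp(-D) times its maximal
likelihood, and the latter sum to at most n + 1. The bound does not depend on the success
probability, even near 0 or 1. -/
theorem IsModel.measure_not_fit_le (h : IsModel P n K τ ν X) {k : Fin (K + 1)} {a b : ℕ}
    (ha : τ k.castSucc ≤ a) (hab : a < b) (hb : b ≤ τ k.succ) (v D : ℝ) :
    P {ω | ¬ Real.exp (segLL (fun i => X i ω) v a b) ≤
        Real.exp D * ∏ i ∈ Finset.Ico a b, lik (fun i => X i ω) v (cdf (ν k) v) i} ≤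
      ENNReal.ofReal (Real.exp (-D) * (n + 1)) := by
  set q := cdf (ν k) v with hq
  let bad : Finset (Finset ℕ) := (Finset.Ico a b).powerset.filter fun T =>
    Real.exp D * (q ^ T.card * (1 - q) ^ (b - a - T.card)) < maxLik (b - a) T.card
  have hsub : {ω | ¬ Real.exp (segLL (fun i => X i ω) v a b) ≤
        Real.exp D * ∏ i ∈ Finset.Ico a b, lik (fun i => X i ω) v q i} ⊆
      ⋃ T ∈ bad, {ω | (Finset.Ico a b).filter (fun i => X i ω ≤ v) = T} := by
    intro ω hω
    simp only [Set.mem_iUnion, Set.mem_ofPred_eq]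
    refine ⟨_, ?_, rfl⟩
    simp only [bad, Finset.mem_filter, Finset.mem_powerset, Finset.filter_subset, true_and]
    have h1 := not_le.1 hω
    rw [exp_segLL _ _ hab.le, prod_lik, prod_lik] at h1
    refine h1.trans_eq ?_
    rw [maxLik, empCDF, Nat.cast_sub hab.le]
  refine (measure_mono hsub).trans ((measure_biUnion_finset_le _ _).trans ?_)
  have hle : ∀ T ∈ bad, P {ω | (Finset.Ico a b).filter (fun i => X i ω ≤ v) = T} ≤
      ENNReal.ofReal (Real.exp (-D) * maxLik (b - a) T.card) := by
    intro T hT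
    simp only [bad, Finset.mem_filter, Finset.mem_powerset] at hT
    refine (h.measure_pattern ha hb v hT.1).trans (ENNReal.ofReal_le_ofReal ?_)
    have h1 := mul_le_mul_of_nonneg_left hT.2.le (Real.exp_pos (-D)).le
    rw [← mul_assoc, ← Real.exp_add, neg_add_cancel, Real.exp_zero, one_mul] at h1
    exact h1
  have hcard : ∀ T ∈ (Finset.Ico a b).powerset, T.card ≤ b - a := fun T hT => by
    have := Finset.card_le_card (Finset.mem_powerset.1 hT)
    rwa [Nat.card_Ico] at this
  have hnn : ∀ T ∈ (Finset.Ico a b).powerset, 0 ≤ Real.exp (-D) * maxLik (b - a) T.card :=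
    fun T hT => mul_nonneg (Real.exp_pos _).le (maxLik_nonneg (hcard T hT))
  refine (Finset.sum_le_sum hle).trans ?_
  rw [← ENNReal.ofReal_sum_of_nonneg fun T hT => hnn T (Finset.mem_filter.1 hT).1]
  refine ENNReal.ofReal_le_ofReal ?_
  refine (Finset.sum_le_sum_of_subset_of_nonneg (Finset.filter_subset _ _)
    fun T hT _ => hnn T hT).trans ?_
  rw [← Finset.mul_sum]
  refine mul_le_mul_of_nonneg_left ?_ (Real.exp_pos _).le
  have h1 := sum_powerset_maxLik_le (Finset.Ico a b)
  rw [Nat.card_Ico] at h1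
  have h2 : ((b - a : ℕ) : ℝ) ≤ n := by
    have h1 := (h.segmentation.bounds k.castSucc).1
    have h2 := (h.segmentation.bounds k.succ).2
    exact_mod_cast (by omega : b - a ≤ n)
  linarith

/-- Uniform fit over finitely many levels. -/
theorem IsModel.measure_not_fits_le (h : IsModel P n K τ ν X) (V : Finset ℝ) (D : ℝ) :
    P {ω | ∃ v ∈ V, ¬ Fits (fun i => X i ω) v τ (fun k => cdf (ν k) v) D} ≤
      ENNReal.ofReal (V.card * (n + 1) ^ 3 * Real.exp (-D)) := by
  let bad : ℝ → Fin (K + 1) → ℕ → ℕ → Set Ω := fun v k a b =>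
    {ω | ¬ Real.exp (segLL (fun i => X i ω) v a b) ≤
        Real.exp D * ∏ i ∈ Finset.Ico a b, lik (fun i => X i ω) v (cdf (ν k) v) i}
  let idx : Finset (ℝ × Fin (K + 1) × ℕ × ℕ) :=
    (V ×ˢ Finset.univ ×ˢ Finset.Icc 1 (n + 1) ×ˢ Finset.Icc 1 (n + 1)).filter fun z =>
      τ z.2.1.castSucc ≤ z.2.2.1 ∧ z.2.2.1 < z.2.2.2 ∧ z.2.2.2 ≤ τ z.2.1.succ
  have hcard : idx.card ≤ V.card * (n + 1) ^ 2 := by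
    have : idx.card ≤ (V ×ˢ Finset.Icc 1 (n + 1) ×ˢ Finset.Icc 1 (n + 1)).card := by
      -- A nonempty interval inside a true segment determines that segment, so k contributes no
      -- factor to the count.
      refine Finset.card_le_card_of_injOn (fun z => (z.1, z.2.2.1, z.2.2.2)) ?_ ?_
      · intro z hz
        simp only [idx, Finset.coe_filter, Finset.mem_product, Set.mem_ofPred_eq] at hz
        simp only [Finset.coe_product, Set.mem_prod, Finset.mem_coe]
        exact ⟨hz.1.1, hz.1.2.2.1, hz.1.2.2.2⟩
      · rintro ⟨v, k, a, b⟩ hz ⟨v', k', a', b'⟩ hz' he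
        simp only [idx, Finset.coe_filter, Set.mem_ofPred_eq] at hz hz'
        simp only [Prod.mk.injEq] at he ⊢
        obtain ⟨rfl, rfl, rfl⟩ := he
        exact ⟨rfl, segment_unique h.segmentation.1.monotone hz'.2.1
          (hz'.2.2.1.trans_le hz'.2.2.2) hz.2.1 (hz.2.2.1.trans_le hz.2.2.2), rfl, rfl⟩
    refine this.trans_eq ?_
    simp only [Finset.card_product, Nat.card_Icc, Nat.add_sub_cancel]
    ring
  have hsub : {ω | ∃ v ∈ V, ¬ Fits (fun i => X i ω) v τ (fun k => cdf (ν k) v) D} ⊆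
      ⋃ z ∈ idx, bad z.1 z.2.1 z.2.2.1 z.2.2.2 := by
    rintro ω ⟨v, hv, hω⟩
    unfold Fits at hω
    push Not at hω
    obtain ⟨k, a, b, ha, hab, hb, hlt⟩ := hω
    have h1 := (h.segmentation.bounds k.castSucc).1
    have h2 := (h.segmentation.bounds k.succ).2
    simp only [Set.mem_iUnion]
    refine ⟨(v, k, a, b), ?_, not_le.2 hlt⟩
    simp only [idx, Finset.mem_filter, Finset.mem_product, Finset.mem_univ, Finset.mem_Icc]
    refine ⟨⟨hv, trivial, ⟨by omega, by omega⟩, by omega, by omega⟩, ha, hab, hb⟩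
  refine (measure_mono hsub).trans ((measure_biUnion_finset_le _ _).trans ?_)
  refine (Finset.sum_le_card_nsmul _ _ (ENNReal.ofReal (Real.exp (-D) * (n + 1)))
    fun z hz => ?_).trans ?_
  · simp only [idx, Finset.mem_filter] at hz
    exact h.measure_not_fit_le hz.2.1 hz.2.2.1 hz.2.2.2 z.1 D
  · rw [nsmul_eq_mul, ← ENNReal.ofReal_natCast, ← ENNReal.ofReal_mul (Nat.cast_nonneg _)]
    refine ENNReal.ofReal_le_ofReal ?_
    have h1 : (idx.card : ℝ) ≤ V.card * (n + 1) ^ 2 := by exact_mod_cast hcard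
    have h2 : 0 ≤ Real.exp (-D) * ((n : ℝ) + 1) := by positivity
    refine (mul_le_mul_of_nonneg_right h1 h2).trans_eq ?_
    ring

/-- The probability that two observations fall into the same cell of a finite partition. -/
theorem IsModel.measure_collision_le (h : IsModel P n K τ ν X) (hn : 1 ≤ n) {cell : ℝ → ℕ}
    (hcell : Measurable cell) {N : ℕ} {δ : ℝ} (hδ : 0 ≤ δ) (hN : ∀ x, cell x ∈ Finset.Icc 1 N)
    (hmass : ∀ g ∈ Finset.Icc 1 N, (pooledLaw n τ ν).real {x | cell x = g} ≤ δ) :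
    P {ω | ¬ Set.InjOn (fun i => cell (X i ω)) (Set.Icc 1 n)} ≤
      ENNReal.ofReal (n ^ 2 * N * (n * δ) ^ 2) := by
  have hms : ∀ g, MeasurableSet {x | cell x = g} := fun g => hcell (measurableSet_singleton g)
  -- A segment may have length 1, so its law has at most n times the pooled mass of a cell.
  have hone : ∀ i ∈ Finset.Icc 1 n, ∀ g ∈ Finset.Icc 1 N,
      P (X i ⁻¹' {x | cell x = g}) ≤ ENNReal.ofReal (n * δ) := by
    intro i hi g hg
    rw [Finset.mem_Icc] at hi
    obtain ⟨k, h1, h2⟩ := h.segmentation.exists_segment hi.1 hi.2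
    have := h.isProbabilityMeasure k
    have h3 : P (X i ⁻¹' {x | cell x = g}) = ν k {x | cell x = g} :=
      (h.law k i h1 h2).measure_eq (p := fun x => cell x = g) (hms g)
    rw [h3, ← ofReal_measureReal]
    refine ENNReal.ofReal_le_ofReal ?_
    have h4 := h.length_mul_le hn {x | cell x = g} k
    have h5 := h.segmentation.length_nonneg k
    have h6 : 0 ≤ (ν k).real {x | cell x = g} := measureReal_nonneg
    have h7 := mul_le_mul_of_nonneg_left (hmass g hg) (Nat.cast_nonneg (α := ℝ) n)
    nlinarith
  let idx : Finset (ℕ × ℕ × ℕ) :=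
    (Finset.Icc 1 n ×ˢ Finset.Icc 1 n ×ˢ Finset.Icc 1 N).filter fun z => z.1 ≠ z.2.1
  have hsub : {ω | ¬ Set.InjOn (fun i => cell (X i ω)) (Set.Icc 1 n)} ⊆
      ⋃ z ∈ idx, ⋂ i ∈ ({z.1, z.2.1} : Finset ℕ), X i ⁻¹' {x | cell x = z.2.2} := by
    intro ω hω
    simp only [Set.InjOn, Set.mem_ofPred_eq] at hω
    push Not at hω
    obtain ⟨i, hi, j, hj, he, hne⟩ := hω
    simp only [Set.mem_iUnion]
    refine ⟨(i, j, cell (X i ω)), ?_, ?_⟩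
    · simp only [idx, Finset.mem_filter, Finset.mem_product]
      exact ⟨⟨Finset.mem_Icc.2 hi, Finset.mem_Icc.2 hj, hN _⟩, hne⟩
    · simp [he]
  refine (measure_mono hsub).trans ((measure_biUnion_finset_le _ _).trans ?_)
  have hcard : (idx.card : ℝ) ≤ n ^ 2 * N := by
    have := Finset.card_filter_le (Finset.Icc 1 n ×ˢ Finset.Icc 1 n ×ˢ Finset.Icc 1 N)
      (fun z => z.1 ≠ z.2.1)
    simp only [Finset.card_product, Nat.card_Icc, Nat.add_sub_cancel] at this
    have h1 : (idx.card : ℝ) ≤ ((n * (n * N) : ℕ) : ℝ) := by exact_mod_cast this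
    refine h1.trans_eq ?_
    push_cast
    ring
  refine (Finset.sum_le_card_nsmul _ _ (ENNReal.ofReal ((n * δ) ^ 2)) fun z hz => ?_).trans ?_
  · simp only [idx, Finset.mem_filter, Finset.mem_product] at hz
    rw [h.measure_iInter (sets := fun _ => {x | cell x = z.2.2}) ?_ (fun _ => hms _),
      Finset.prod_pair hz.2, sq, ENNReal.ofReal_mul (by positivity)]
    · exact mul_le_mul' (hone _ hz.1.1 _ hz.1.2.2) (hone _ hz.1.2.1 _ hz.1.2.2)
    · intro i hi
      rw [Finset.mem_insert, Finset.mem_singleton] at hi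
      rcases hi with rfl | rfl
      · exact hz.1.1
      · exact hz.1.2.1
  · rw [nsmul_eq_mul, ← ENNReal.ofReal_natCast, ← ENNReal.ofReal_mul (Nat.cast_nonneg _)]
    exact ENNReal.ofReal_le_ofReal (mul_le_mul_of_nonneg_right hcard (by positivity))

end Model

/-! ### The signal of a change-point -/

section Signal

variable {Ω : Type*} [MeasurableSpace Ω] {P : Measure Ω} [IsProbabilityMeasure P]
  {n K : ℕ} {τ : Fin (K + 2) → ℕ} {ν : Fin (K + 1) → Measure ℝ} {X : ℕ → Ω → ℝ}

/-- Hellinger counterpart of the integrand of the signal. -/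
noncomputable def hellRatio (n : ℕ) {K : ℕ} (τ : Fin (K + 2) → ℕ) (ν : Fin (K + 1) → Measure ℝ)
    (r : Fin K) (u : ℝ) : ℝ :=
  hell (cdf (ν r.castSucc) u) (cdf (ν r.succ) u) /
    (cdf (pooledLaw n τ ν) u * (1 - cdf (pooledLaw n τ ν) u))

/-- The central region of the pooled sample. -/
def central (n : ℕ) {K : ℕ} (τ : Fin (K + 2) → ℕ) (ν : Fin (K + 1) → Measure ℝ) (δ : ℝ) : Set ℝ :=
  {u | δ < cdf (pooledLaw n τ ν) u ∧ cdf (pooledLaw n τ ν) u ≤ 1 - δ}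

theorem pooled_denom_nonneg (n : ℕ) (τ : Fin (K + 2) → ℕ) (ν : Fin (K + 1) → Measure ℝ) (u : ℝ) :
    0 ≤ cdf (pooledLaw n τ ν) u * (1 - cdf (pooledLaw n τ ν) u) :=
  mul_nonneg (cdf_nonneg _ _) (sub_nonneg.2 (cdf_le_one _ _))

theorem hellRatio_nonneg (n : ℕ) (τ : Fin (K + 2) → ℕ) (ν : Fin (K + 1) → Measure ℝ) (r : Fin K)
    (u : ℝ) : 0 ≤ hellRatio n τ ν r u :=
  div_nonneg (hell_nonneg _ _) (pooled_denom_nonneg n τ ν u)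

theorem measurable_hellRatio (n : ℕ) (τ : Fin (K + 2) → ℕ) (ν : Fin (K + 1) → Measure ℝ)
    (r : Fin K) : Measurable (hellRatio n τ ν r) := by
  have h : ∀ μ : Measure ℝ, Measurable (cdf μ) := fun μ => (monotone_cdf μ).measurable
  have h1 := h (ν r.castSucc)
  have h2 := h (ν r.succ)
  have h3 := h (pooledLaw n τ ν)
  unfold hellRatio hell
  fun_prop

theorem measurableSet_central (n : ℕ) (τ : Fin (K + 2) → ℕ) (ν : Fin (K + 1) → Measure ℝ)
    (δ : ℝ) : MeasurableSet (central n τ ν δ) := by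
  have h3 := (monotone_cdf (pooledLaw n τ ν)).measurable
  exact (measurableSet_lt measurable_const h3).inter (measurableSet_le h3 measurable_const)

/-- Domination by the pooled law gives |p - q| ≤ (n / lam) min(F, 1-F), and min(F, 1-F) ≤ 2F(1-F);
the last factor 2 is from `hell_le_abs`. Where F(1-F) = 0 the ratio is 0 by division by zero. -/
theorem IsModel.hellRatio_le (h : IsModel P n K τ ν X) (hn : 1 ≤ n) {lam : ℝ} (hl : 0 < lam)
    (hlam : ∀ k : Fin (K + 1), lam ≤ (τ k.succ : ℝ) - τ k.castSucc) (r : Fin K) (u : ℝ) :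
    hellRatio n τ ν r u ≤ 4 * n / lam := by
  have := h.isProbabilityMeasure
  have := h.isProbabilityMeasure_pooledLaw hn
  set F := cdf (pooledLaw n τ ν) u with hF
  have hF0 : 0 ≤ F := cdf_nonneg _ _
  have hF1 : F ≤ 1 := cdf_le_one _ _
  have low : ∀ k, lam * cdf (ν k) u ≤ n * F := fun k => by
    have h1 := h.length_mul_le hn (Set.Iic u) k
    rw [← cdf_eq_real, ← cdf_eq_real] at h1
    exact (mul_le_mul_of_nonneg_right (hlam k) (cdf_nonneg _ _)).trans h1
  have upp : ∀ k, lam * (1 - cdf (ν k) u) ≤ n * (1 - F) := fun k => by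
    have h1 := h.length_mul_le hn (Set.Iic u)ᶜ k
    rw [probReal_compl_eq_one_sub measurableSet_Iic, probReal_compl_eq_one_sub measurableSet_Iic,
      ← cdf_eq_real, ← cdf_eq_real] at h1
    exact (mul_le_mul_of_nonneg_right (hlam k) (sub_nonneg.2 (cdf_le_one _ _))).trans h1
  have hh := hell_le_abs (cdf_mem_Icc (ν r.castSucc) u) (cdf_mem_Icc (ν r.succ) u)
  set p := cdf (ν r.castSucc) u
  set q := cdf (ν r.succ) u
  have hp := cdf_mem_Icc (ν r.castSucc) u
  have hq := cdf_mem_Icc (ν r.succ) u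
  have l1 := low r.castSucc
  have l2 := low r.succ
  have u1 := upp r.castSucc
  have u2 := upp r.succ
  have a1 : lam * |p - q| ≤ n * F := by
    rw [← abs_of_pos hl, ← abs_mul, abs_le]
    constructor <;> nlinarith [hp.1, hq.1]
  have a2 : lam * |p - q| ≤ n * (1 - F) := by
    rw [← abs_of_pos hl, ← abs_mul, abs_le]
    constructor <;> nlinarith [hp.2, hq.2]
  unfold hellRatio
  rw [← hF]
  rcases (mul_nonneg hF0 (sub_nonneg.2 hF1)).eq_or_lt with h0 | h0
  · rw [← h0, div_zero]
    positivity
  rw [div_le_div_iff₀ h0 hl]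
  have hn0 : (0 : ℝ) ≤ n := Nat.cast_nonneg n
  rcases le_total F (1 / 2) with hc | hc
  · nlinarith [mul_nonneg hn0 (mul_nonneg hF0 (show 0 ≤ 1 - 2 * F by linarith))]
  · nlinarith [mul_nonneg hn0 (mul_nonneg (sub_nonneg.2 hF1) (show 0 ≤ 2 * F - 1 by linarith))]

theorem integrable_of_measurable_of_bounded {μ : Measure ℝ} [IsFiniteMeasure μ] {f : ℝ → ℝ}
    (hf : Measurable f) {b : ℝ} (h0 : ∀ u, 0 ≤ f u) (hb : ∀ u, f u ≤ b) : Integrable f μ :=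
  Integrable.of_bound hf.aestronglyMeasurable b
    (Eventually.of_forall fun u => by rw [Real.norm_of_nonneg (h0 u)]; exact hb u)

theorem indicator_bounds {f : ℝ → ℝ} {b : ℝ} (h0 : ∀ u, 0 ≤ f u) (hb : ∀ u, f u ≤ b) (s : Set ℝ)
    (u : ℝ) : 0 ≤ s.indicator f u ∧ s.indicator f u ≤ b := by
  refine ⟨Set.indicator_nonneg (fun u _ => h0 u) u, ?_⟩
  by_cases hu : u ∈ s
  · rw [Set.indicator_of_mem hu]; exact hb u
  · rw [Set.indicator_of_notMem hu]; exact (h0 u).trans (hb u)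

/-- Outside the central region, of pooled mass at most 2δ, the integrand is at most twice the bound
4n / lam of `hellRatio_le`. Truncation therefore costs at most 16nδ / lam. -/
theorem IsModel.signal_le (h : IsModel P n K τ ν X) (hn : 1 ≤ n)
    (hc : ∀ k, Continuous (cdf (ν k))) {lam : ℝ} (hl : 0 < lam)
    (hlam : ∀ k : Fin (K + 1), lam ≤ (τ k.succ : ℝ) - τ k.castSucc) (r : Fin K)
    {δ : ℝ} (h0 : 0 ≤ δ) (h1 : δ ≤ 1) :
    signal n τ ν r ≤
      2 * ∫ u, (central n τ ν δ).indicator (hellRatio n τ ν r) u ∂(pooledLaw n τ ν) +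
        16 * n / lam * δ := by
  have := h.isProbabilityMeasure_pooledLaw hn
  have hF := h.continuous_cdf_pooledLaw hn hc
  set μ := pooledLaw n τ ν with hμ
  set b : ℝ := 4 * n / lam with hb
  have hb0 : 0 ≤ b := by positivity
  have hbd := h.hellRatio_le hn hl hlam r
  have hnn := hellRatio_nonneg n τ ν r
  have hmeas := measurable_hellRatio n τ ν r
  have hms := measurableSet_central n τ ν δ
  have hphi := indicator_bounds hnn hbd (central n τ ν δ)
  have hint := integrable_of_measurable_of_bounded (μ := μ) (hmeas.indicator hms)
    (fun u => (hphi u).1) (fun u => (hphi u).2)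
  have hcompl : μ.real (central n τ ν δ)ᶜ ≤ 2 * δ := by
    have hsub : (central n τ ν δ)ᶜ ⊆ {x | cdf μ x ≤ δ} ∪ {x | 1 - δ < cdf μ x} := by
      intro x hx
      by_contra hcon
      simp only [Set.mem_union, Set.mem_ofPred_eq, not_or, not_le, not_lt] at hcon
      exact hx hcon
    have h2 := (measureReal_mono hsub (by finiteness)).trans (measureReal_union_le (μ := μ) _ _)
    rw [measureReal_cdf_le hF h0 h1, measureReal_lt_cdf hF (by linarith) (by linarith)] at h2
    linarith
  have hind : Integrable ((central n τ ν δ)ᶜ.indicator fun _ => (1 : ℝ)) μ :=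
    (integrable_const 1).indicator hms.compl
  have hindI : ∫ u, (central n τ ν δ)ᶜ.indicator (fun _ => (1 : ℝ)) u ∂μ
      = μ.real (central n τ ν δ)ᶜ := by
    rw [integral_indicator hms.compl]
    simp
  have hphi0 : 0 ≤ ∫ u, (central n τ ν δ).indicator (hellRatio n τ ν r) u ∂μ :=
    integral_nonneg fun u => (hphi u).1
  unfold signal
  by_cases hI : Integrable (fun u => etaFun (ν r.castSucc) (ν r.succ) u /
    (cdf (pooledLaw n τ ν) u * (1 - cdf (pooledLaw n τ ν) u))) μ
  · have hpt : ∀ u, etaFun (ν r.castSucc) (ν r.succ) u /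
        (cdf (pooledLaw n τ ν) u * (1 - cdf (pooledLaw n τ ν) u)) ≤
        2 * (central n τ ν δ).indicator (hellRatio n τ ν r) u +
          2 * b * (central n τ ν δ)ᶜ.indicator (fun _ => (1 : ℝ)) u := by
      intro u
      have e1 : etaFun (ν r.castSucc) (ν r.succ) u /
          (cdf (pooledLaw n τ ν) u * (1 - cdf (pooledLaw n τ ν) u)) ≤
          2 * hellRatio n τ ν r u := by
        rw [hellRatio, ← mul_div_assoc]
        exact div_le_div_of_nonneg_right
          (bernoulliKL_mid_add_le (cdf_mem_Icc _ _) (cdf_mem_Icc _ _))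
          (pooled_denom_nonneg n τ ν u)
      by_cases hu : u ∈ central n τ ν δ
      · rw [Set.indicator_of_mem hu, Set.indicator_of_notMem (by simpa using hu)]
        linarith
      · rw [Set.indicator_of_notMem hu, Set.indicator_of_mem (by simpa using hu)]
        linarith [hbd u]
    have h2 := integral_mono hI ((hint.const_mul 2).add (hind.const_mul (2 * b))) hpt
    rw [integral_add' (hint.const_mul 2) (hind.const_mul (2 * b)), integral_const_mul,
      integral_const_mul, hindI] at h2
    refine h2.trans ?_
    have h3 := mul_le_mul_of_nonneg_left hcompl (show 0 ≤ 2 * b by linarith)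
    have e : 16 * n / lam * δ = 2 * b * (2 * δ) := by rw [hb]; ring
    rw [e]
    linarith
  -- A non-integrable integrand has Bochner integral 0, and the right side is nonnegative.
  · rw [integral_undef hI]
    positivity

theorem IsModel.sum_integral_eq (h : IsModel P n K τ ν X) (hn : 1 ≤ n) {φ : ℝ → ℝ}
    (hφ : Measurable φ) {b : ℝ} (h0 : ∀ u, 0 ≤ φ u) (hb : ∀ u, φ u ≤ b) :
    ∑ i ∈ Finset.Icc 1 n, ∫ ω, φ (X i ω) ∂P = n * ∫ u, φ u ∂(pooledLaw n τ ν) := by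
  have := h.isProbabilityMeasure
  have e1 : Finset.Icc 1 n = Finset.Ico (τ 0) (τ (Fin.last (K + 1))) := by
    rw [h.segmentation.2.1, h.segmentation.2.2]
    rfl
  rw [e1, ← sum_sum_Ico _ τ h.segmentation.1.monotone, pooledLaw, integral_finsetSum_measure,
    Finset.mul_sum]
  · refine Finset.sum_congr rfl fun k _ => ?_
    have e2 : ∀ i ∈ Finset.Ico (τ k.castSucc) (τ k.succ), ∫ ω, φ (X i ω) ∂P = ∫ u, φ u ∂(ν k) := by
      intro i hi
      rw [Finset.mem_Ico] at hi
      exact (h.law k i hi.1 hi.2).integral_comp hφ.aestronglyMeasurable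
    have h1 := h.segmentation.length_nonneg k
    have hn' : (0 : ℝ) < n := by positivity
    rw [Finset.sum_congr rfl e2, Finset.sum_const, Nat.card_Ico, nsmul_eq_mul,
      Nat.cast_sub (h.segmentation.1.monotone (Fin.castSucc_le_succ k)), integral_smul_measure,
      ENNReal.toReal_ofReal (by positivity), smul_eq_mul]
    field_simp
  · intro k _
    exact (integrable_of_measurable_of_bounded hφ h0 hb).smul_measure ENNReal.ofReal_ne_top

/-- A lower deviation bound for sums of bounded functions of the observations. -/
theorem IsModel.measure_sum_lt_le (h : IsModel P n K τ ν X) (hn : 1 ≤ n) {φ : ℝ → ℝ}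
    (hφ : Measurable φ) {b : ℝ} (h0 : ∀ u, 0 ≤ φ u) (hb : ∀ u, φ u ≤ b)
    {m : ℝ} (hm : m = ∫ u, φ u ∂(pooledLaw n τ ν)) (hm0 : 0 < m) :
    P {ω | ∑ i ∈ Finset.Icc 1 n, φ (X i ω) < n * m / 2} ≤ ENNReal.ofReal (4 * b / (n * m)) := by
  have hn' : (0 : ℝ) < n := by positivity
  have hXm : ∀ i : Finset.Icc 1 n, AEMeasurable (X i) P := fun i => by
    obtain ⟨k, h1, h2⟩ := h.segmentation.exists_segment (Finset.mem_Icc.1 i.2).1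
      (Finset.mem_Icc.1 i.2).2
    exact (h.law k i h1 h2).aemeasurable
  let Y : Finset.Icc 1 n → Ω → ℝ := fun i => φ ∘ X i
  have hYm : ∀ i, AEStronglyMeasurable (Y i) P := fun i =>
    (hφ.comp_aemeasurable (hXm i)).aestronglyMeasurable
  have hYb : ∀ i, ∀ᵐ ω ∂P, Y i ω ∈ Set.Icc 0 b := fun i =>
    Eventually.of_forall fun ω => ⟨h0 _, hb _⟩
  have hY2 : ∀ i, MemLp (Y i) 2 P := fun i => memLp_of_bounded (hYb i) (hYm i) 2
  have hind : iIndepFun Y P := h.indep.comp (fun _ => φ) (fun _ => hφ)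
  have hsum : ∀ f : ℕ → ℝ, ∑ i : Finset.Icc 1 n, f i = ∑ i ∈ Finset.Icc 1 n, f i :=
    fun f => Finset.sum_coe_sort (Finset.Icc 1 n) f
  have hmean : ∫ ω, (∑ i, Y i) ω ∂P = n * m := by
    simp only [Finset.sum_apply]
    rw [integral_finsetSum _ fun i _ => (hY2 i).integrable (by norm_num)]
    rw [hm, ← h.sum_integral_eq hn hφ h0 hb, ← hsum]
    rfl
  -- Since 0 ≤ φ ≤ b, each variance is at most b times the mean. The large bound b thus enters only
  -- linearly in Chebyshev's inequality.
  have hvar : variance (∑ i, Y i) P ≤ b * (n * m) := by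
    rw [IndepFun.variance_sum (fun i _ => hY2 i) (fun i _ j _ hij => hind.indepFun hij),
      hm, ← h.sum_integral_eq hn hφ h0 hb, ← hsum (fun i => ∫ ω, φ (X i ω) ∂P), Finset.mul_sum]
    refine Finset.sum_le_sum fun i _ => ?_
    have h1 := variance_le_sub_mul_sub (hYb i) (hYm i).aemeasurable
    rw [sub_zero] at h1
    have h2 : 0 ≤ ∫ ω, Y i ω ∂P := integral_nonneg fun ω => h0 _
    refine h1.trans (mul_le_mul_of_nonneg_right ?_ h2)
    linarith
  have hcheb := meas_ge_le_variance_div_sq (memLp_finsetSum' Finset.univ fun i _ => hY2 i)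
    (show 0 < n * m / 2 by positivity)
  refine (measure_mono ?_).trans (hcheb.trans (ENNReal.ofReal_le_ofReal ?_))
  · intro ω hω
    have hω' : ∑ i ∈ Finset.Icc 1 n, φ (X i ω) < n * m / 2 := hω
    have h2 : (∑ i, Y i) ω = ∑ i ∈ Finset.Icc 1 n, φ (X i ω) := by
      rw [Finset.sum_apply, ← hsum (fun i => φ (X i ω))]
      rfl
    rw [Set.mem_ofPred_eq, hmean, h2, abs_sub_comm]
    refine le_trans ?_ (le_abs_self _)
    linarith
  · rw [div_le_div_iff₀ (by positivity) (by positivity)]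
    have := mul_le_mul_of_nonneg_right hvar (show 0 ≤ n * m by positivity)
    nlinarith

end Signal

/-! ### Ranks -/

theorem mul_le_of_mul_hell_le {m p q D : ℝ} (hm : 0 ≤ m) (hp : p ∈ Set.Icc (0 : ℝ) 1)
    (hq : q ∈ Set.Icc (0 : ℝ) 1) (h : m * hell p q ≤ D) :
    m * p ≤ 2 * (m * q) + 2 * D ∧ m * (1 - p) ≤ 2 * (m * (1 - q)) + 2 * D := by
  have key : ∀ {x y : ℝ}, 0 ≤ x → 0 ≤ y → x ≤ 2 * y + 2 * (√x - √y) ^ 2 := by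
    intro x y hx hy
    nlinarith [Real.sq_sqrt hx, Real.sq_sqrt hy, sq_nonneg (√x - 2 * √y)]
  have k1 := key hp.1 hq.1
  have k2 := key (sub_nonneg.2 hp.2) (sub_nonneg.2 hq.2)
  have s1 : (√p - √q) ^ 2 ≤ hell p q := by
    unfold hell; linarith [sq_nonneg (√(1 - p) - √(1 - q))]
  have s2 : (√(1 - p) - √(1 - q)) ^ 2 ≤ hell p q := by
    unfold hell; linarith [sq_nonneg (√p - √q)]
  have m1 := mul_le_mul_of_nonneg_left (show p ≤ 2 * q + 2 * hell p q by linarith) hm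
  have m2 := mul_le_mul_of_nonneg_left
    (show 1 - p ≤ 2 * (1 - q) + 2 * hell p q by linarith) hm
  constructor <;> nlinarith

theorem sum_length_mul_empCDF {n L : ℕ} {t : Fin (L + 2) → ℕ} (ht : IsSegmentation n L t)
    (x : ℕ → ℝ) (v : ℝ) :
    ∑ k : Fin (L + 1), ((t k.succ : ℝ) - t k.castSucc) * empCDF x (t k.castSucc) (t k.succ) v =
      (((Finset.Ico 1 (n + 1)).filter fun i => x i ≤ v).card : ℝ) := by
  have h := sum_sum_Ico (fun i => if x i ≤ v then (1 : ℝ) else 0) t ht.1.monotone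
  rw [ht.2.1, ht.2.2] at h
  simp only [Finset.sum_boole] at h
  rw [← h]
  exact Finset.sum_congr rfl fun k _ =>
    empCDF_mul_length x v (ht.1.monotone (Fin.castSucc_le_succ k))

section Ranks

variable {Ω : Type*} [MeasurableSpace Ω] {P : Measure Ω} [IsProbabilityMeasure P]
  {n K : ℕ} {τ : Fin (K + 2) → ℕ} {ν : Fin (K + 1) → Measure ℝ} {X : ℕ → Ω → ℝ}

/-- Hellinger closeness is multiplicative: x ≤ 2y + 2(√x - √y)². Summed over the segments, it
compares both tail counts with nF and n(1-F) up to a factor 2 and an error of order (K + 1) D. -/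
theorem IsModel.card_le_of_fits (h : IsModel P n K τ ν X) (hn : 1 ≤ n) {x : ℕ → ℝ} {v D : ℝ}
    (hfit : Fits x v τ (fun k => cdf (ν k) v) D) :
    (((Finset.Ico 1 (n + 1)).filter fun i => x i ≤ v).card : ℝ) ≤
        2 * (n * cdf (pooledLaw n τ ν) v) + 2 * ((K + 1) * D) ∧
      n - (((Finset.Ico 1 (n + 1)).filter fun i => x i ≤ v).card : ℝ) ≤
        2 * (n * (1 - cdf (pooledLaw n τ ν) v)) + 2 * ((K + 1) * D) := by
  have hn' : (n : ℝ) ≠ 0 := by positivity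
  have hseg : ∀ k : Fin (K + 1), τ k.castSucc < τ k.succ :=
    fun k => h.segmentation.1 Fin.castSucc_lt_succ
  have hk : ∀ k : Fin (K + 1), _ := fun k =>
    mul_le_of_mul_hell_le (zero_le_one.trans (h.segmentation.length_nonneg k))
      (empCDF_mem_Icc x v (hseg k).le) (cdf_mem_Icc (ν k) v)
      (hfit.hell_le (fun k => cdf_mem_Icc (ν k) v) le_rfl (hseg k) le_rfl)
  have hF : n * cdf (pooledLaw n τ ν) v =
      ∑ k : Fin (K + 1), ((τ k.succ : ℝ) - τ k.castSucc) * cdf (ν k) v := by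
    rw [h.cdf_pooledLaw hn, Finset.mul_sum]
    refine Finset.sum_congr rfl fun k _ => ?_
    field_simp
  have hlen := sum_length_eq h.segmentation
  have hcnt := sum_length_mul_empCDF h.segmentation x v
  have s1 := Finset.sum_le_sum fun k (_ : k ∈ Finset.univ) => (hk k).1
  have s2 := Finset.sum_le_sum fun k (_ : k ∈ Finset.univ) => (hk k).2
  simp only [mul_sub, mul_one, Finset.sum_add_distrib, Finset.sum_sub_distrib, Finset.sum_const,
    Finset.card_univ, Fintype.card_fin, nsmul_eq_mul, ← Finset.mul_sum] at s1 s2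
  rw [Finset.sum_sub_distrib] at hlen
  rw [hcnt, ← hF] at s1 s2
  push_cast at s1 s2
  constructor <;> linarith

/-- The weighted Hellinger signal at the order statistics, bounded below by an average over the
sample. -/
theorem IsModel.le_sum_weight_mul_hell (h : IsModel P n K τ ν X) (hn : 3 ≤ n) {x : ℕ → ℝ}
    (hinj : Set.InjOn x (Set.Icc 1 n)) {v : ℕ → ℝ} {D δ ε b : ℝ} (hε : 0 ≤ ε) (hδ : 0 ≤ δ)
    (hv : ∀ l ∈ Finset.Icc 2 (n - 1), ∀ i ∈ Finset.Icc 1 n, x i ≤ orderStat n x l ↔ x i ≤ v l)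
    (hle : ∀ l ∈ Finset.Icc 2 (n - 1), orderStat n x l ≤ v l)
    (hclose : ∀ l ∈ Finset.Icc 2 (n - 1),
      n * (cdf (pooledLaw n τ ν) (v l) - cdf (pooledLaw n τ ν) (orderStat n x l)) ≤ ε)
    (hfit : ∀ l ∈ Finset.Icc 2 (n - 1), Fits x (v l) τ (fun k => cdf (ν k) (v l)) D)
    (hδD : 2 * ε + 2 * ((K + 1) * D) ≤ n * δ) (r : Fin K)
    (hb : ∀ u, hellRatio n τ ν r u ≤ b) :
    (∑ i ∈ Finset.Icc 1 n, (central n τ ν δ).indicator (hellRatio n τ ν r) (x i) - 2 * b) /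
        (27 * n) - 16 * ε * Real.log n ≤
      ∑ l ∈ Finset.Icc 2 (n - 1),
        weight n l * hell (cdf (ν r.castSucc) (v l)) (cdf (ν r.succ) (v l)) := by
  set φ := (central n τ ν δ).indicator (hellRatio n τ ν r) with hφ
  have hφb := indicator_bounds (hellRatio_nonneg n τ ν r) hb (central n τ ν δ)
  have hn0 : (0 : ℝ) < n := by positivity
  have hpt : ∀ l ∈ Finset.Icc 2 (n - 1), φ (orderStat n x l) / (27 * n) - weight n l * (4 * ε) ≤
      weight n l * hell (cdf (ν r.castSucc) (v l)) (cdf (ν r.succ) (v l)) := by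
    intro l hl
    have hl' := Finset.mem_Icc.1 hl
    have hw := weight_nonneg (n := n) (l := l) (by omega)
    set y := orderStat n x l with hy
    -- A segment has length at least 1, so each segment C.D.F. moves by at most ε between `y` and `v
    -- l`.
    have hdiff : ∀ k, hell (cdf (ν k) y) (cdf (ν k) (v l)) ≤ 2 * ε := by
      intro k
      have h1 := h.length_mul_cdf_sub_le (by omega) (hle l hl) k
      have h2 := h.segmentation.length_nonneg k
      have h3 := monotone_cdf (ν k) (hle l hl)
      have h4 := hell_le_abs (cdf_mem_Icc (ν k) y) (cdf_mem_Icc (ν k) (v l))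
      rw [abs_sub_comm, abs_of_nonneg (sub_nonneg.2 h3)] at h4
      have h5 := hclose l hl
      nlinarith
    have htri := hell_le_three_mul (cdf (ν r.castSucc) y) (cdf (ν r.castSucc) (v l))
      (cdf (ν r.succ) (v l)) (cdf (ν r.succ) y)
    have d1 := hdiff r.castSucc
    have d2 := hdiff r.succ
    rw [hell_comm] at d2
    have hg : hell (cdf (ν r.castSucc) y) (cdf (ν r.succ) y) / 3 - 4 * ε ≤
        hell (cdf (ν r.castSucc) (v l)) (cdf (ν r.succ) (v l)) := by linarith
    have hphi : φ y / (9 * n) ≤ weight n l * hell (cdf (ν r.castSucc) y) (cdf (ν r.succ) y) := by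
      by_cases hyc : y ∈ central n τ ν δ
      · rw [hφ, Set.indicator_of_mem hyc, hellRatio]
        obtain ⟨c1, c2⟩ := hyc
        have hcard := h.card_le_of_fits (by omega) (hfit l hl)
        have hfil : (Finset.Ico 1 (n + 1)).filter (fun i => x i ≤ v l) =
            (Finset.Ico 1 (n + 1)).filter (fun i => x i ≤ y) :=
          Finset.filter_congr fun i hi => (hv l hl i hi).symm
        rw [hfil, hy, card_le_orderStat hinj (by omega) (by omega)] at hcard
        have hcl := hclose l hl
        have hmon := monotone_cdf (pooledLaw n τ ν) (hle l hl)
        rw [← hy] at hcl hmon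
        set F := cdf (pooledLaw n τ ν) y
        have hF0 : 0 < F := hδ.trans_lt c1
        -- In the central region the additive errors are at most nδ ≤ nF, which raises the factor 2
        -- to 3; likewise for n - l.
        have q1 : (l : ℝ) ≤ 3 * (n * F) := by
          have := mul_le_mul_of_nonneg_left c1.le hn0.le
          linarith [hcard.1]
        have q2 : (n : ℝ) - l ≤ 3 * (n * (1 - F)) := by
          have := mul_le_mul_of_nonneg_left c2 hn0.le
          have := mul_le_mul_of_nonneg_left hmon hn0.le
          linarith [hcard.2]
        have p1 : (0 : ℝ) < l := by exact_mod_cast (by omega : 0 < l)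
        have p2 : (0 : ℝ) < (n : ℝ) - l := by
          have : (l : ℝ) < n := by exact_mod_cast (by omega : l < n)
          linarith
        have hF1 : 0 < 1 - F := by
          by_contra hc
          have : n * (1 - F) ≤ 0 := mul_nonpos_of_nonneg_of_nonpos hn0.le (not_lt.1 hc)
          linarith
        have hww : 1 / (9 * n * (F * (1 - F))) ≤ weight n l := by
          rw [weight, div_le_div_iff₀ (by positivity) (by positivity)]
          have := mul_le_mul q1 q2 p2.le (by positivity)
          nlinarith
        refine le_trans (le_of_eq ?_) (mul_le_mul_of_nonneg_right hww (hell_nonneg _ _))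
        field_simp
      · rw [hφ, Set.indicator_of_notMem hyc, zero_div]
        exact mul_nonneg hw (hell_nonneg _ _)
    have h1 := mul_le_mul_of_nonneg_left hg hw
    have e : φ y / (27 * n) = φ y / (9 * n) / 3 := by ring
    rw [e]
    linarith
  have hsum := Finset.sum_le_sum hpt
  rw [Finset.sum_sub_distrib, ← Finset.sum_div, ← Finset.sum_mul] at hsum
  have hW := mul_le_mul_of_nonneg_right (sum_weight_le hn) (show 0 ≤ 4 * ε by linarith)
  -- The objective omits l = 1 and l = n; these two terms cost at most b each.
  have hall : ∑ i ∈ Finset.Icc 1 n, φ (x i) ≤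
      ∑ l ∈ Finset.Icc 2 (n - 1), φ (orderStat n x l) + 2 * b := by
    rw [← sum_orderStat n x φ]
    have e1 : Finset.Icc 1 n = insert 1 (insert n (Finset.Icc 2 (n - 1))) := by
      ext i
      simp only [Finset.mem_insert, Finset.mem_Icc]
      omega
    rw [e1, Finset.sum_insert (by simp; omega), Finset.sum_insert (by simp; omega)]
    linarith [(hφb (orderStat n x 1)).2, (hφb (orderStat n x n)).2]
  have hdiv : (∑ i ∈ Finset.Icc 1 n, φ (x i) - 2 * b) / (27 * n) ≤
      (∑ l ∈ Finset.Icc 2 (n - 1), φ (orderStat n x l)) / (27 * n) :=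
    div_le_div_of_nonneg_right (by linarith) (by positivity)
  linarith

end Ranks

/-! ### The quantile grid -/

/-- Index of the cell of the quantile grid of `μ` with `N` cells that contains `x`. -/
noncomputable def cell (μ : Measure ℝ) (N : ℕ) (x : ℝ) : ℕ := max 1 ⌈N * cdf μ x⌉₊

section Cell

variable {μ : Measure ℝ} {N : ℕ}

theorem cell_le_iff {x : ℝ} {g : ℕ} (hg : 1 ≤ g) : cell μ N x ≤ g ↔ N * cdf μ x ≤ g := by
  rw [cell, max_le_iff, Nat.ceil_le]
  exact and_iff_right hg

theorem cell_mem_Icc (hN : 1 ≤ N) (x : ℝ) : cell μ N x ∈ Finset.Icc 1 N := by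
  rw [Finset.mem_Icc]
  refine ⟨le_max_left _ _, (cell_le_iff hN).2 ?_⟩
  exact mul_le_of_le_one_right (Nat.cast_nonneg N) (cdf_le_one μ x)

theorem cell_mono : Monotone (cell μ N) := fun _ _ hxy =>
  max_le_max le_rfl
    (Nat.ceil_mono (mul_le_mul_of_nonneg_left (monotone_cdf μ hxy) (Nat.cast_nonneg N)))

theorem cell_sub_one_le (x : ℝ) : (cell μ N x : ℝ) - 1 ≤ N * cdf μ x := by
  have h0 : 0 ≤ N * cdf μ x := mul_nonneg (Nat.cast_nonneg N) (cdf_nonneg μ x)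
  have h1 := (Nat.ceil_lt_add_one h0).le
  rw [cell, Nat.cast_max, sub_le_iff_le_add]
  exact max_le (by push_cast; linarith) h1

theorem measurable_cell : Measurable (cell μ N) := cell_mono.measurable

theorem exists_grid (hc : Continuous (cdf μ)) : ∃ u : ℕ → ℝ, ∀ g, 1 ≤ g → g < N →
    (∀ x, cell μ N x ≤ g ↔ x ≤ u g) ∧ N * cdf μ (u g) = g := by
  have h : ∀ g : ℕ, ∃ u : ℝ, 1 ≤ g → g < N →
      (∀ x, cell μ N x ≤ g ↔ x ≤ u) ∧ N * cdf μ u = g := by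
    intro g
    by_cases hg : 1 ≤ g ∧ g < N
    · have hN : (0 : ℝ) < N := by exact_mod_cast (by omega : 0 < N)
      have hg0 : (0 : ℝ) < g := by exact_mod_cast hg.1
      have hgN : (g : ℝ) < N := by exact_mod_cast hg.2
      obtain ⟨u, hu, hu'⟩ := exists_setOf_cdf_le_eq_Iic hc (div_pos hg0 hN)
        ((div_lt_one hN).2 hgN)
      refine ⟨u, fun _ _ => ⟨fun x => ?_, ?_⟩⟩
      · rw [cell_le_iff hg.1, mul_comm, ← le_div_iff₀ hN]
        exact Set.ext_iff.1 hu x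
      · rw [hu']
        field_simp
    · exact ⟨0, fun h1 h2 => absurd ⟨h1, h2⟩ hg⟩
  choose u hu using h
  exact ⟨u, hu⟩

theorem measureReal_cell_le [IsProbabilityMeasure μ] (hc : Continuous (cdf μ)) {g : ℕ}
    (hg : g ∈ Finset.Icc 1 N) :
    μ.real {x | cell μ N x = g} ≤ 1 / N := by
  rw [Finset.mem_Icc] at hg
  have hN : (0 : ℝ) < N := by exact_mod_cast (by omega : 0 < N)
  have hgN : (g : ℝ) / N ≤ 1 := div_le_one_of_le₀ (by exact_mod_cast hg.2) hN.le
  rcases hg.1.eq_or_lt with h1 | h1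
  · have hsub : {x | cell μ N x = g} ⊆ {x | cdf μ x ≤ g / N} := fun x hx => by
      have := (cell_le_iff hg.1).1 (show cell μ N x ≤ g from le_of_eq hx)
      rw [Set.mem_ofPred_eq, le_div_iff₀ hN]
      linarith
    refine (measureReal_mono hsub).trans ?_
    rw [measureReal_cdf_le hc (by positivity) hgN, ← h1]
    simp
  · have hsub : {x | cell μ N x = g} ⊆ {x | ((g : ℝ) - 1) / N < cdf μ x ∧ cdf μ x ≤ g / N} := by
      intro x hx
      have hx' : cell μ N x = g := hx
      have h2 := (cell_le_iff hg.1).1 (show cell μ N x ≤ g from le_of_eq hx)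
      have h3 : ¬ cell μ N x ≤ g - 1 := by omega
      rw [cell_le_iff (by omega), not_le, Nat.cast_sub hg.1, Nat.cast_one] at h3
      rw [Set.mem_ofPred_eq, le_div_iff₀ hN, div_lt_iff₀ hN]
      constructor <;> linarith
    have hg1 : (1 : ℝ) ≤ g := by exact_mod_cast hg.1
    refine (measureReal_mono hsub).trans ?_
    rw [measureReal_cdf_mem_Ioc hc (div_nonneg (by linarith) hN.le)
      (div_le_div_of_nonneg_right (by linarith) hN.le) hgN, ← sub_div]
    simp

end Cell

/-- When all observations lie in different cells, an order statistic may be replaced by the upper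
end of its cell. -/
theorem orderStat_grid {μ : Measure ℝ} {N n : ℕ} (hN : 1 ≤ N) {u : ℕ → ℝ}
    (hu : ∀ g, 1 ≤ g → g < N → (∀ x, cell μ N x ≤ g ↔ x ≤ u g) ∧ N * cdf μ (u g) = g)
    {x : ℕ → ℝ} (hinj : Set.InjOn (fun i => cell μ N (x i)) (Set.Icc 1 n)) {l : ℕ}
    (h1 : 1 ≤ l) (h2 : l < n) :
    cell μ N (orderStat n x l) < N ∧
      (∀ i ∈ Finset.Icc 1 n, x i ≤ orderStat n x l ↔ x i ≤ u (cell μ N (orderStat n x l))) ∧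
      orderStat n x l ≤ u (cell μ N (orderStat n x l)) ∧
      N * (cdf μ (u (cell μ N (orderStat n x l))) - cdf μ (orderStat n x l)) ≤ 1 := by
  have hxinj : Set.InjOn x (Set.Icc 1 n) := fun i hi j hj hij =>
    hinj hi hj (by simp only [hij])
  have hcard := card_le_orderStat hxinj h1 h2.le
  obtain ⟨j, hj, hyj⟩ := orderStat_mem x h1 h2.le
  set y := orderStat n x l with hy
  set g := cell μ N y with hg
  have key : ∀ i ∈ Finset.Icc 1 n, cell μ N (x i) ≤ g → x i ≤ y := by
    intro i hi hle
    by_contra hc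
    have h3 : cell μ N (x i) = cell μ N (x j) := by
      rw [← hyj]
      exact le_antisymm hle (cell_mono (not_le.1 hc).le)
    have h4 := hinj (Finset.mem_Icc.1 hi) (Finset.mem_Icc.1 hj) h3
    rw [h4, ← hyj] at hc
    exact hc le_rfl
  obtain ⟨i, hi, hiy⟩ : ∃ i ∈ Finset.Icc 1 n, ¬ x i ≤ y := by
    by_contra! hc
    have h5 : (Finset.Ico 1 (n + 1)).filter (fun i => x i ≤ y) = Finset.Ico 1 (n + 1) :=
      Finset.filter_true_of_mem hc
    rw [h5, Nat.card_Ico] at hcard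
    omega
  have hg1 : 1 ≤ g := le_max_left _ _
  -- As l < n, some observation exceeds `y`; it lies in a strictly higher cell, so `y` is not in the
  -- top cell, for which the grid has no end point.
  have hgN : g < N := by
    by_contra hc
    exact hiy (key i hi (((Finset.mem_Icc.1 (cell_mem_Icc hN (x i))).2).trans (not_lt.1 hc)))
  obtain ⟨hu1, hu2⟩ := hu g hg1 hgN
  refine ⟨hgN, fun i hi => ?_, (hu1 y).1 le_rfl, ?_⟩
  · rw [← hu1]
    exact ⟨fun h => cell_mono h, key i hi⟩
  · rw [mul_sub, hu2]
    have := cell_sub_one_le (μ := μ) (N := N) y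
    linarith

/-! ### The selected number of change-points at a fixed sample size -/

section Selection

variable {Ω : Type*} [MeasurableSpace Ω] {P : Measure Ω} [IsProbabilityMeasure P]
  {n K : ℕ} {τ : Fin (K + 2) → ℕ} {ν : Fin (K + 1) → Measure ℝ} {X : ℕ → Ω → ℝ}

theorem card_mul_exp_le (hn : 3 ≤ n) {m : ℕ} (hm : m ≤ n ^ 5) :
    (m : ℝ) * (n + 1) ^ 3 * Real.exp (-(10 * Real.log n)) ≤ 8 / n := by
  have hn3 : (3 : ℝ) ≤ n := by exact_mod_cast hn
  have hn0 : (0 : ℝ) < n := by linarith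
  have e : Real.exp (-(10 * Real.log n)) = ((n : ℝ) ^ 10)⁻¹ := by
    rw [Real.exp_neg, mul_comm, Real.exp_mul, Real.exp_log hn0]
    norm_cast
  have hm' : (m : ℝ) ≤ (n : ℝ) ^ 5 := by exact_mod_cast hm
  have h1 : ((n : ℝ) + 1) ^ 3 ≤ (2 * n) ^ 3 := pow_le_pow_left₀ (by positivity) (by linarith) 3
  have h2 : (m : ℝ) * (n + 1) ^ 3 ≤ (n : ℝ) ^ 5 * (2 * n) ^ 3 :=
    mul_le_mul hm' h1 (by positivity) (by positivity)
  rw [e, ← div_eq_mul_inv, div_le_div_iff₀ (by positivity) hn0]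
  have h3 : (n : ℝ) ^ 9 ≤ (n : ℝ) ^ 10 := pow_le_pow_right₀ (by linarith) (by norm_num)
  nlinarith

/-- Three exceptional events: two observations in one cell (1/n), a failure of `Fits` at some grid
level (8/n), and a sample signal below half its mean (16 / (lam * m r) ≤ 64 / (lam * η₀) for each
change). Off them the argument is deterministic. -/
theorem IsModel.measure_ne_le (h : IsModel P n K τ ν X) (hn : 3 ≤ n) (hK : 1 ≤ K) {Kbar : ℕ}
    (hKbar : K ≤ Kbar) (hKn : Kbar < n) (hc : ∀ k, Continuous (cdf (ν k))) {lam : ℝ}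
    (hl : 2 ≤ lam) (hlam : ∀ k : Fin (K + 1), lam ≤ (τ k.succ : ℝ) - τ k.castSucc)
    {η₀ : ℝ} (hη0 : 0 < η₀) (hη1 : η₀ ≤ 1) (hsig : ∀ r, η₀ ≤ signal n τ ν r) {ζ : ℝ} (hζ : 0 < ζ)
    (hlog : 2 + 20 * (K + 1) * Real.log n ≤ η₀ * lam / 32)
    (hsmall : 8 / (27 * lam) + 16 * (Real.log n / n ^ 4) ≤ η₀ / 432)
    (hpen : 120 * Real.log n ^ 2 * ((Kbar + 1) * Kbar) ≤ ζ / 2)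
    (hgap : 2 * ζ ≤ lam / 24 * (η₀ / 432))
    {Khat : Ω → ℕ} (hKhat : ∀ ω, IsBICMinimizer n (fun i => X i ω) ζ Kbar (Khat ω)) :
    P {ω | Khat ω ≠ K} ≤ ENNReal.ofReal (9 / n + 64 * K / (lam * η₀)) := by
  have hn1 : 1 ≤ n := by omega
  have hn3 : (3 : ℝ) ≤ n := by exact_mod_cast hn
  have hn0 : (0 : ℝ) < n := by linarith
  have hl0 : 0 < lam := by linarith
  have hlogn : 0 ≤ Real.log n := Real.log_nonneg (by linarith)
  have := h.isProbabilityMeasure_pooledLaw hn1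
  have hF := h.continuous_cdf_pooledLaw hn1 hc
  set μ := pooledLaw n τ ν with hμ
  -- With n⁵ cells a collision has probability at most n² · n⁵ · (n · n⁻⁵)² = 1/n, and moving a
  -- level changes nF by at most n⁻⁴.
  set N : ℕ := n ^ 5 with hNdef
  have hN1 : 1 ≤ N := Nat.one_le_pow _ _ (by omega)
  have hNr : (N : ℝ) = (n : ℝ) ^ 5 := by rw [hNdef]; push_cast; rfl
  have hN0 : (0 : ℝ) < N := by rw [hNr]; positivity
  obtain ⟨u, hu⟩ := exists_grid (N := N) hF
  have hlamn : lam ≤ n := by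
    have h1 := hlam 0
    have h2 := sum_length_eq h.segmentation
    have h3 := Finset.single_le_sum (s := Finset.univ)
      (f := fun k : Fin (K + 1) => (τ k.succ : ℝ) - τ k.castSucc)
      (fun k _ => zero_le_one.trans (h.segmentation.length_nonneg k)) (Finset.mem_univ 0)
    simp only [h2] at h3
    linarith
  -- Chosen so that truncation removes exactly η₀ / 2 of the signal, while nδ = η₀ lam / 32 still
  -- dominates the rank errors of order K log n.
  set δ : ℝ := η₀ * lam / (32 * n) with hδ
  have hδ0 : 0 ≤ δ := by positivity
  have hδ1 : δ ≤ 1 := by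
    rw [hδ, div_le_one (by positivity)]
    nlinarith
  set φ : Fin K → ℝ → ℝ := fun r => (central n τ ν δ).indicator (hellRatio n τ ν r) with hφ
  set m : Fin K → ℝ := fun r => ∫ x, φ r x ∂μ with hm
  have hm4 : ∀ r, η₀ / 4 ≤ m r := by
    intro r
    have h1 := (hsig r).trans (h.signal_le hn1 hc hl0 hlam r hδ0 hδ1)
    have h2 : 16 * n / lam * δ = η₀ / 2 := by
      rw [hδ]; field_simp; norm_num
    rw [h2] at h1
    change _ ≤ 2 * m r + _ at h1
    linarith
  have hb := fun r => h.hellRatio_le hn1 hl0 hlam r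
  have hφb := fun r => indicator_bounds (hellRatio_nonneg n τ ν r) (hb r) (central n τ ν δ)
  have hφm : ∀ r, Measurable (φ r) := fun r =>
    (measurable_hellRatio n τ ν r).indicator (measurableSet_central n τ ν δ)
  let V : Finset ℝ := (Finset.Ico 1 N).image u
  have hVcard : V.card ≤ N := Finset.card_image_le.trans (by rw [Nat.card_Ico]; omega)
  have hsub : {ω | Khat ω ≠ K} ⊆
      ({ω | ¬ Set.InjOn (fun i => cell μ N (X i ω)) (Set.Icc 1 n)} ∪
        {ω | ∃ v ∈ V, ¬ Fits (fun i => X i ω) v τ (fun k => cdf (ν k) v) (10 * Real.log n)}) ∪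
      ⋃ r ∈ (Finset.univ : Finset (Fin K)),
        {ω | ∑ i ∈ Finset.Icc 1 n, φ r (X i ω) < n * m r / 2} := by
    intro ω hω
    by_contra hcon
    simp only [Set.mem_union, Set.mem_iUnion, Set.mem_ofPred_eq, not_or, not_not, not_exists,
      not_and, not_lt, Finset.mem_univ, true_imp_iff] at hcon
    obtain ⟨⟨hinj, hfits⟩, hsum⟩ := hcon
    apply hω
    set x : ℕ → ℝ := fun i => X i ω with hx
    have hxinj : Set.InjOn x (Set.Icc 1 n) := fun i hi j hj hij =>
      hinj hi hj (congrArg (cell μ N) hij)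
    have hgrid := fun (l : ℕ) (hl : l ∈ Finset.Icc 2 (n - 1)) =>
      orderStat_grid (n := n) hN1 hu (x := x) hinj (l := l)
        (by rw [Finset.mem_Icc] at hl; omega) (by rw [Finset.mem_Icc] at hl; omega)
    set v : ℕ → ℝ := fun l => u (cell μ N (orderStat n x l)) with hv
    have hfit : ∀ l ∈ Finset.Icc 2 (n - 1),
        Fits x (v l) τ (fun k => cdf (ν k) (v l)) (10 * Real.log n) := fun l hl =>
      hfits _ (Finset.mem_image_of_mem u
        (Finset.mem_Ico.2 ⟨(Finset.mem_Icc.1 (cell_mem_Icc hN1 _)).1, (hgrid l hl).1⟩))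
    have hκ : ∀ r : Fin K, η₀ / 432 ≤ ∑ l ∈ Finset.Icc 2 (n - 1),
        weight n l * hell (cdf (ν r.castSucc) (v l)) (cdf (ν r.succ) (v l)) := by
      intro r
      have hε1 : ((n : ℝ) ^ 4)⁻¹ ≤ 1 := inv_le_one_of_one_le₀ (one_le_pow₀ (by linarith))
      have h1 := h.le_sum_weight_mul_hell hn hxinj (v := v) (D := 10 * Real.log n) (δ := δ)
        (ε := ((n : ℝ) ^ 4)⁻¹) (by positivity) hδ0
        (fun l hl => (hgrid l hl).2.1) (fun l hl => (hgrid l hl).2.2.1)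
        (fun l hl => by
          have h2 := (hgrid l hl).2.2.2
          rw [hNr] at h2
          rw [← one_div, le_div_iff₀ (by positivity)]
          refine le_trans (le_of_eq ?_) h2
          simp only [hv]
          ring)
        hfit
        (by
          have e : n * δ = η₀ * lam / 32 := by rw [hδ]; field_simp
          rw [e]
          refine le_trans ?_ hlog
          linarith)
        r (hb r)
      refine le_trans ?_ h1
      have h3 : n * m r / 2 ≤ ∑ i ∈ Finset.Icc 1 n,
          (central n τ ν δ).indicator (hellRatio n τ ν r) (x i) := hsum r
      have h4 : (n * (η₀ / 4) / 2 - 2 * (4 * n / lam)) / (27 * n) ≤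
          (∑ i ∈ Finset.Icc 1 n, (central n τ ν δ).indicator (hellRatio n τ ν r) (x i) -
            2 * (4 * n / lam)) / (27 * n) := by
        refine div_le_div_of_nonneg_right ?_ (by positivity)
        have := mul_le_mul_of_nonneg_left (hm4 r) hn0.le
        linarith
      have e1 : (n * (η₀ / 4) / 2 - 2 * (4 * n / lam)) / (27 * n) =
          η₀ / 216 - 8 / (27 * lam) := by
        field_simp
        ring
      have e2 : 16 * ((n : ℝ) ^ 4)⁻¹ * Real.log n = 16 * (Real.log n / n ^ 4) := by
        field_simp
      rw [e1] at h4
      rw [e2]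
      linarith
    refine eq_of_isBICMinimizer h.segmentation hK hKbar hKn hζ ?_ (hKhat ω)
    intro L hL t ht
    have h1 := Rn_le h.segmentation hn hK (q := fun l k => cdf (ν k) (v l))
      (fun l k => cdf_mem_Icc _ _) (show 0 ≤ 10 * Real.log n by positivity)
      (show 0 ≤ η₀ / 432 by positivity) hl hlam (fun l hl => (hgrid l hl).2.1) hfit hκ ht
    have h2 : ((L : ℝ) + 1) * K ≤ (Kbar + 1) * Kbar := by
      have a1 : (L : ℝ) ≤ Kbar := by exact_mod_cast hL
      have a2 : (K : ℝ) ≤ Kbar := by exact_mod_cast hKbar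
      exact mul_le_mul (by linarith) a2 (Nat.cast_nonneg _) (by positivity)
    have h3 := mul_le_mul_of_nonneg_left h2 (show 0 ≤ 120 * Real.log n ^ 2 by positivity)
    have h4 := mul_le_mul_of_nonneg_right hgap (Nat.cast_nonneg (α := ℝ) (K - L))
    nlinarith
  have p1 : P {ω | ¬ Set.InjOn (fun i => cell μ N (X i ω)) (Set.Icc 1 n)} ≤
      ENNReal.ofReal (1 / n) := by
    refine (h.measure_collision_le hn1 measurable_cell (δ := 1 / N) (by positivity)
      (cell_mem_Icc hN1) (fun g hg => measureReal_cell_le hF hg)).trans_eq ?_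
    rw [hNr]
    congr 1
    field_simp
  have p2 : P {ω | ∃ v ∈ V, ¬ Fits (fun i => X i ω) v τ (fun k => cdf (ν k) v)
      (10 * Real.log n)} ≤ ENNReal.ofReal (8 / n) :=
    (h.measure_not_fits_le V _).trans (ENNReal.ofReal_le_ofReal (card_mul_exp_le hn hVcard))
  have p3 : P (⋃ r ∈ (Finset.univ : Finset (Fin K)),
      {ω | ∑ i ∈ Finset.Icc 1 n, φ r (X i ω) < n * m r / 2}) ≤
      ENNReal.ofReal (64 * K / (lam * η₀)) := by
    refine (measure_biUnion_finset_le _ _).trans ?_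
    refine (Finset.sum_le_card_nsmul _ _ (ENNReal.ofReal (64 / (lam * η₀))) fun r _ => ?_).trans ?_
    · have hmr : 0 < m r := lt_of_lt_of_le (by positivity) (hm4 r)
      refine (h.measure_sum_lt_le hn1 (hφm r) (fun y => (hφb r y).1) (fun y => (hφb r y).2)
        rfl hmr).trans (ENNReal.ofReal_le_ofReal ?_)
      change 4 * (4 * n / lam) / (n * m r) ≤ _
      have e : 4 * (4 * n / lam) / (n * m r) = 16 / (lam * m r) := by
        field_simp
        norm_num
      rw [e, div_le_div_iff₀ (by positivity) (by positivity)]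
      have := mul_le_mul_of_nonneg_left (hm4 r) hl0.le
      linarith
    · rw [nsmul_eq_mul, ← ENNReal.ofReal_natCast, ← ENNReal.ofReal_mul (Nat.cast_nonneg _)]
      refine ENNReal.ofReal_le_ofReal (le_of_eq ?_)
      rw [Finset.card_univ, Fintype.card_fin]
      ring
  refine (measure_mono hsub).trans ((measure_union_le _ _).trans ?_)
  refine (add_le_add ((measure_union_le _ _).trans (add_le_add p1 p2)) p3).trans_eq ?_
  rw [← ENNReal.ofReal_add (by positivity) (by positivity),
    ← ENNReal.ofReal_add (by positivity) (by positivity)]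
  congr 2
  ring

end Selection

/-! ### Asymptotics -/

theorem le_minSpacing {K : ℕ} {t : Fin (K + 2) → ℕ} (ht : StrictMono t) (k : Fin (K + 1)) :
    (minSpacing t : ℝ) ≤ (t k.succ : ℝ) - t k.castSucc := by
  have h : minSpacing t ≤ t k.succ - t k.castSucc :=
    Finset.inf'_le (fun k : Fin (K + 1) => t k.succ - t k.castSucc) (Finset.mem_univ k)
  rw [← Nat.cast_sub (ht.monotone (Fin.castSucc_le_succ k))]
  exact_mod_cast h

theorem minSpacing_le {n K : ℕ} {t : Fin (K + 2) → ℕ} (ht : IsSegmentation n K t) :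
    (minSpacing t : ℝ) ≤ n := by
  have h1 := le_minSpacing ht.1 0
  have h2 := Finset.single_le_sum (s := Finset.univ)
    (f := fun k : Fin (K + 1) => (t k.succ : ℝ) - t k.castSucc)
    (fun k _ => zero_le_one.trans (ht.length_nonneg k)) (Finset.mem_univ 0)
  simp only [sum_length_eq ht] at h2
  linarith

/-- The penalty dominates `K̄² (log n)²`. -/
theorem eventually_le_zeta {c : ℝ} (hc : 0 < c) (B : ℝ) :
    ∀ᶠ n : ℕ in atTop, ∀ k : ℕ, 2 ≤ k → B * ((k : ℝ) ^ 2 * Real.log n ^ 2) ≤ zeta c n k := by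
  have hlog : Tendsto (fun n : ℕ => Real.log n) atTop atTop :=
    Real.tendsto_log_atTop.comp tendsto_natCast_atTop_atTop
  filter_upwards [((tendsto_rpow_atTop hc).comp hlog).eventually_ge_atTop (4 * |B|),
    hlog.eventually_ge_atTop 1] with n h1 h2 k hk
  have h1' : 4 * |B| ≤ Real.log n ^ c := h1
  have hk2 : (2 : ℝ) ≤ k := by exact_mod_cast hk
  have hl2 : 1 / 2 ≤ Real.log k := by
    have := Real.log_two_gt_d9
    have := Real.log_le_log (by norm_num) hk2
    linarith
  have hl4 : 1 / 4 ≤ Real.log k ^ 2 := by nlinarith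
  have hsplit : Real.log n ^ (2 + c) = Real.log n ^ 2 * Real.log n ^ c := by
    rw [Real.rpow_add (by linarith)]
    norm_cast
  have hlogn : 0 ≤ Real.log n ^ 2 := sq_nonneg _
  unfold zeta
  rw [hsplit]
  calc B * ((k : ℝ) ^ 2 * Real.log n ^ 2) ≤ |B| * ((k : ℝ) ^ 2 * Real.log n ^ 2) :=
        mul_le_mul_of_nonneg_right (le_abs_self B) (by positivity)
    _ = (k : ℝ) ^ 2 * (1 / 4) * (Real.log n ^ 2 * (4 * |B|)) := by ring
    _ ≤ (k : ℝ) ^ 3 * Real.log k ^ 2 * (Real.log n ^ 2 * Real.log n ^ c) := by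
        refine mul_le_mul ?_ (mul_le_mul_of_nonneg_left h1' hlogn) (by positivity) (by positivity)
        refine mul_le_mul ?_ hl4 (by norm_num) (by positivity)
        exact pow_le_pow_right₀ (by linarith) (by norm_num)

theorem eventually_log_div_pow_le {ε : ℝ} (hε : 0 < ε) :
    ∀ᶠ n : ℕ in atTop, Real.log n / (n : ℝ) ^ 4 ≤ ε := by
  filter_upwards [tendsto_natCast_atTop_atTop.eventually_ge_atTop (1 / ε),
    eventually_ge_atTop 1] with n h1 h2
  have hn1 : (1 : ℝ) ≤ n := by exact_mod_cast h2
  have hlog : Real.log n ≤ n := (Real.log_le_sub_one_of_pos (by linarith)).trans (by linarith)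
  rw [div_le_iff₀ (by positivity)]
  have h3 : (n : ℝ) ^ 2 ≤ (n : ℝ) ^ 4 := pow_le_pow_right₀ hn1 (by norm_num)
  rw [div_le_iff₀ hε] at h1
  nlinarith [mul_le_mul_of_nonneg_left h3 hε.le]

/-- The four summands of the rate constant serve, in order, the gap 2ζ, the rank errors, Kbar < n
and the failure probability. The factor 480 = 120 · 2 · 2 comes from (k + 1) k ≤ 2k² and the target
ζ / 2. -/
theorem rate_consequences {η ε lam k κ ζ ℓ : ℝ} (hη : 0 < η) (hε : 0 < ε) (hk : 2 ≤ k)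
    (hκ : κ ≤ k) (hℓ : 1 ≤ ℓ) (hz : 480 * (k ^ 2 * ℓ ^ 2) ≤ ζ)
    (hrate : (24 * 2 * 432 / η + 32 * 42 / η + 2 + 128 / (η * ε)) * (k * ζ) ≤ lam) :
    0 < ζ ∧ 2 * k ≤ lam ∧ 2 + 20 * (κ + 1) * ℓ ≤ η * lam / 32 ∧
      120 * ℓ ^ 2 * ((k + 1) * k) ≤ ζ / 2 ∧ 2 * ζ ≤ lam / 24 * (η / 432) ∧
      64 * κ / (lam * η) ≤ ε / 2 := by
  have k1 : 1 ≤ k ^ 2 := by nlinarith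
  have l1 : ℓ ≤ ℓ ^ 2 := by nlinarith
  have hzl : ℓ ≤ ζ := by
    have := mul_le_mul_of_nonneg_right k1 (sq_nonneg ℓ)
    linarith
  have hz1 : 1 ≤ ζ := hℓ.trans hzl
  have hkζ : k ≤ k * ζ := le_mul_of_one_le_right (by linarith) hz1
  have hζk : ζ ≤ k * ζ := le_mul_of_one_le_left (by linarith) (by linarith)
  have hkz : 0 ≤ k * ζ := by linarith
  have t1 : 0 ≤ 24 * 2 * 432 / η := by positivity
  have t2 : 0 ≤ 32 * 42 / η := by positivity
  have t3 : 0 ≤ 128 / (η * ε) := by positivity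
  have r1 : 24 * 2 * 432 / η * (k * ζ) ≤ lam :=
    (mul_le_mul_of_nonneg_right (by linarith) hkz).trans hrate
  have r2 : 32 * 42 / η * (k * ζ) ≤ lam :=
    (mul_le_mul_of_nonneg_right (by linarith) hkz).trans hrate
  have r3 : 2 * (k * ζ) ≤ lam :=
    (mul_le_mul_of_nonneg_right (by linarith) hkz).trans hrate
  have r4 : 128 / (η * ε) * (k * ζ) ≤ lam :=
    (mul_le_mul_of_nonneg_right (by linarith) hkz).trans hrate
  rw [div_mul_eq_mul_div, div_le_iff₀ (by positivity)] at r1 r2 r4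
  have hlam : 0 < lam := by linarith
  refine ⟨by linarith, by linarith, ?_, ?_, by linarith, ?_⟩
  · have a1 : k * ℓ ≤ k * ζ := mul_le_mul_of_nonneg_left hzl (by linarith)
    have a2 : (κ + 1) * ℓ ≤ 3 / 2 * k * ℓ :=
      mul_le_mul_of_nonneg_right (by linarith) (by linarith)
    have a3 : 2 * 1 ≤ k * ℓ := mul_le_mul hk hℓ zero_le_one (by linarith)
    linarith
  · have a1 : (k + 1) * k ≤ 2 * k ^ 2 := by nlinarith
    have a2 := mul_le_mul_of_nonneg_left a1 (show 0 ≤ 120 * ℓ ^ 2 by positivity)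
    linarith
  · rw [div_le_iff₀ (by positivity)]
    linarith

end NMCD

theorem theorem2 {Ω : Type*} [MeasurableSpace Ω] (P : Measure Ω) [IsProbabilityMeasure P]
    (K Kbar : ℕ → ℕ)
    (τ : ∀ n : ℕ, Fin (K n + 2) → ℕ)
    (ν : ∀ n : ℕ, Fin (K n + 1) → Measure ℝ)
    (X : ℕ → ℕ → Ω → ℝ)
    (hmodel : ∀ᶠ n in atTop, NMCD.IsModel P n (K n) (τ n) (ν n) (X n))
    (hK : ∀ᶠ n in atTop, 1 ≤ K n ∧ K n ≤ Kbar n)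
    -- (A1)
    (hA1 : ∀ᶠ n in atTop, (∀ k : Fin (K n + 1), Continuous (cdf (ν n k))) ∧
      ∀ k : Fin (K n), cdf (ν n k.castSucc) ≠ cdf (ν n k.succ))
    -- (A2)
    (hA2 : Tendsto (fun n => NMCD.minSpacing (τ n)) atTop atTop)
    -- (A3)
    (hA3 : ∀ᵐ ω ∂P, TendstoUniformly
      (fun (n : ℕ) (u : ℝ) => NMCD.empCDF (fun i => X n i ω) 1 (n + 1) u -
        cdf (NMCD.pooledLaw n (τ n) (ν n)) u) (fun _ => 0) atTop)
    -- (A4)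
    (hA4 : ∃ η₀ : ℝ, 0 < η₀ ∧ ∀ᶠ n in atTop, ∀ r : Fin (K n), η₀ ≤ NMCD.signal n (τ n) (ν n) r)
    (c : ℝ) (hc : 0 < c)
    (hrate : ∀ M : ℝ, ∀ᶠ n in atTop,
      M * ((Kbar n : ℝ) * NMCD.zeta c n (Kbar n)) ≤ (NMCD.minSpacing (τ n) : ℝ))
    (Khat : ℕ → Ω → ℕ)
    (hKhat : ∀ᶠ n in atTop, ∀ ω : Ω,
      NMCD.IsBICMinimizer n (fun i => X n i ω) (NMCD.zeta c n (Kbar n)) (Kbar n) (Khat n ω)) :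
    Tendsto (fun n => P {ω | Khat n ω = K n}) atTop (𝓝 1) := by
  obtain ⟨η₁, hη₁, hA4⟩ := hA4
  -- Capping the signal at 1 keeps the truncation level δ at most 1.
  set η₀ : ℝ := min η₁ 1 with hη₀
  have hη0 : 0 < η₀ := lt_min hη₁ one_pos
  have hη1 : η₀ ≤ 1 := min_le_right _ _
  have key : ∀ ε : ℝ, 0 < ε → ∀ᶠ n in atTop, P {ω | Khat n ω ≠ K n} ≤ ENNReal.ofReal ε := by
    intro ε hε
    have hlam : Tendsto (fun n => (NMCD.minSpacing (τ n) : ℝ)) atTop atTop :=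
      tendsto_natCast_atTop_atTop.comp hA2
    have hlogt : Tendsto (fun n : ℕ => Real.log n) atTop atTop :=
      Real.tendsto_log_atTop.comp tendsto_natCast_atTop_atTop
    filter_upwards [hmodel, hK, hA1, hA4, hrate (24 * 2 * 432 / η₀ + 32 * 42 / η₀ + 2 + 128 / (η₀ * ε)), hKhat, eventually_ge_atTop 3,
      NMCD.eventually_le_zeta hc 480, hlam.eventually_ge_atTop 2,
      hlam.eventually_ge_atTop (8 * 864 / (27 * η₀)),
      NMCD.eventually_log_div_pow_le (show 0 < η₀ / (16 * 864) by positivity),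
      hlogt.eventually_ge_atTop 1,
      tendsto_natCast_atTop_atTop.eventually_ge_atTop (18 / ε)]
      with n hmodel hK hA1 hA4 hrate hKhat hn3 hzeta hlam2 hlam3 hlogn hlog1 hnε
    -- If Kbar = 1 the penalty vanishes, but both K and its estimate are forced to be 1. Otherwise
    -- Kbar ≥ 2 and log Kbar is bounded away from 0.
    rcases hK.1.trans hK.2 |>.eq_or_lt with h1 | h2
    · have hempty : {ω | Khat n ω ≠ K n} = ∅ := by
        ext ω
        have h3 := Finset.mem_Icc.1 (hKhat ω).1
        simp only [Set.mem_ofPred_eq, Set.mem_empty_iff_false, iff_false, not_not]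
        omega
      rw [hempty, measure_empty]
      exact zero_le
    have h2r : (2 : ℝ) ≤ Kbar n := by exact_mod_cast h2
    have hKr : (K n : ℝ) ≤ Kbar n := by exact_mod_cast hK.2
    obtain ⟨hζ, hkl, hlog, hpen, hgap, hprob⟩ := NMCD.rate_consequences hη0 hε h2r
      hKr hlog1 (hzeta (Kbar n) h2) hrate
    have hKn : Kbar n < n := by
      have h3 := NMCD.minSpacing_le hmodel.segmentation
      have h4 : (Kbar n : ℝ) < n := by linarith
      exact_mod_cast h4
    have hsmall : 8 / (27 * (NMCD.minSpacing (τ n) : ℝ)) + 16 * (Real.log n / (n : ℝ) ^ 4) ≤ η₀ / 432 := by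
      have a1 : 8 / (27 * (NMCD.minSpacing (τ n) : ℝ)) ≤ η₀ / 864 := by
        rw [div_le_div_iff₀ (by linarith) (by norm_num)]
        rw [div_le_iff₀ (by positivity)] at hlam3
        linarith
      linarith
    refine (hmodel.measure_ne_le hn3 hK.1 hK.2 hKn hA1.1 hlam2
      (NMCD.le_minSpacing hmodel.segmentation.1) hη0 hη1
      (fun r => (min_le_left _ _).trans (hA4 r)) hζ hlog hsmall hpen hgap hKhat).trans
      (ENNReal.ofReal_le_ofReal ?_)
    have hn0 : (0 : ℝ) < n := by exact_mod_cast (by omega : 0 < n)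
    have b1 : 9 / (n : ℝ) ≤ ε / 2 := by
      rw [div_le_iff₀ hε] at hnε
      rw [div_le_iff₀ hn0]
      linarith
    linarith
  have hne : Tendsto (fun n => P {ω | Khat n ω ≠ K n}) atTop (𝓝 0) := by
    rw [ENNReal.tendsto_nhds_zero]
    intro ε hε
    rcases eq_or_ne ε ⊤ with rfl | htop
    · exact Eventually.of_forall fun _ => le_top
    · have h := key ε.toReal (ENNReal.toReal_pos hε.ne' htop)
      rwa [ENNReal.ofReal_toReal htop] at h
  have hlow : Tendsto (fun n => 1 - P {ω | Khat n ω ≠ K n}) atTop (𝓝 1) := by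
    have h := ENNReal.Tendsto.sub (tendsto_const_nhds (x := (1 : ENNReal)) (f := atTop)) hne
      (Or.inl ENNReal.one_ne_top)
    rwa [tsub_zero] at h
  refine tendsto_of_tendsto_of_tendsto_of_le_of_le hlow tendsto_const_nhds (fun n => ?_)
    (fun n => prob_le_one)
  -- The estimator need not be measurable, so subadditivity replaces the complement rule.
  rw [tsub_le_iff_right, ← measure_univ (μ := P)]
  refine (measure_mono fun ω _ => ?_).trans (measure_union_le _ _)
  exact em (Khat n ω = K n)
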